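/- **Setting.** Let $\beta_1,\beta_2,\beta_3>0$, let $X_2=L^2(0,1)^3$ (complex-valued), and define $$L_2\begin{pmatrix}w_1\\w_2\\w_3\end{pmatrix}=\begin{pmatrix}\beta_1w_1''\\\beta_2w_2''\\\beta_3w_3''\end{pmatrix}$$ with domain $D(L_2)=\{(w_1,w_2,w_3)^\top\in H^2(0,1)^3:\ w_3(1)=w_1(0),\ w_1(1)=w_2(0),\ w_2(1)=w_3(0)\}$, together with $G_2,K_2\colon D(L_2)\to\mathbb{C}^3$, $$G_2\begin{pmatrix}w_1\\w_2\\w_3\end{pmatrix}=\begin{pmatrix}w_1(0)\\w_2(0)\\w_3(0)\end{pmatrix},\qquad K_2\begin{pmatrix}w_1\\w_2\\w_3\end{pmatrix}=\begin{pmatrix}\beta_3w_3'(1)-\beta_1w_1'(0)\\\beta_1w_1'(1)-\beta_2w_2'(0)\\\beta_2w_2'(1)-\beta_3w_3'(0)\end{pmatrix}.$$ For Hilbert spaces $X,U$ and linear operators $L\colon D(L)\subseteq X\to X$ and $G,K\colon D(L)\to U$, the triple $(G,L,K)$ is a *boundary node* on $(U,X,U)$ if $G$ and $K$ are bounded from $D(L)$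 (with the graph norm) to $U$, the restriction $A$ of $L$ to $\operatorname{Ker}G$ generates a $C_0$-semigroup on $X$, and $G$ has a bounded linear right-inverse $U\to D(L)$. It is *impedance passive* if $\operatorname{Re}\langle Lx,x\rangle\le\operatorname{Re}\langle Gx,Kx\rangle$ for all $x\in D(L)$. Its *transfer function* is $P\colon\rho(A)\to\mathcal{B}(U)$, $P(\lambda)u=Kx$, where $x\in D(L)$ is the unique solution of $(\lambda-L)x=0$, $Gx=u$. For $T\in\mathcal{B}(U)$ let $\operatorname{Re}T=\frac12(T+T^*)$, and for self-adjoint $S,T\in\mathcal{B}(U)$ write $T\ge S$ if $\langle (T-S)u,u\rangle\ge0$ for all $u\in U$. **Proposition 3.2.** The triple $(G_2,L_2,K_2)$ is an impedance passive boundary node on $(\mathbb{C}^3,X_2,\mathbb{C}^3)$, and the semigroup $(T_2(t))_{t\ge0}$ generated by the restriction $A_2$ of $L_2$ to $\operatorname{Ker}G_2$ is uniformly exponentially stable, i.e. there are $M,\delta>0$ with $\|T_2(t)\|\le Me^{-\delta t}$ for all $t\ge0$. Furthermore, $is$ and $1+is$ lie in $\rho(A_2)$ for all $s\in\mathbb{R}$,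 the transfer function $P_2$ of $(G_2,L_2,K_2)$ exists, there is a constant $C>0$ such that $$\|P_2(1+is)\|\le C\,(1+|s|^{1/2}),\qquad s\in\mathbb{R},$$ and, given any $\varepsilon>0$, there exists a constant $c_\varepsilon>0$ such that $$\operatorname{Re}P_2(is)\ge c_\varepsilon\,(1+|s|^{1/2})\,I,\qquad s\in\mathbb{R}\setminus(-\varepsilon,\varepsilon).$$ The constants $M,\delta,C,c_\varepsilon$ may depend on $\beta_1,\beta_2,\beta_3$. -/

import Mathlib

open MeasureTheory Set Filter Topology
open scoped ContDiff NNReal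

noncomputable section

namespace HeatNetwork

/-! ### Strongly continuous semigroups and their generators -/

section Semigroups

variable {X : Type*} [NormedAddCommGroup X] [NormedSpace ℂ X]

/-- `(T t)_{t ≥ 0}` is a `C₀`-semigroup of bounded linear operators on `X`. -/
structure IsC0Semigroup (T : ℝ≥0 → X →L[ℂ] X) : Prop where
  map_zero : T 0 = 1
  map_add : ∀ s t, T (s + t) = T s * T t
  tendsto_zero : ∀ x, Tendsto (fun t => T t x) (𝓝 0) (𝓝 x)

/-- `A` is the infinitesimal generator of `T`: one has `x ∈ D(A)` and `A x = y` if and only if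
`(T t x - x) / t → y` as `t → 0+`. -/
def IsGeneratorOf (A : X →ₗ.[ℂ] X) (T : ℝ≥0 → X →L[ℂ] X) : Prop :=
  ∀ x y, (x, y) ∈ A.graph ↔
    Tendsto (fun t : ℝ≥0 => (((t : ℝ) : ℂ)⁻¹) • (T t x - x)) (𝓝[>] 0) (𝓝 y)

/-- `A` generates a `C₀`-semigroup on `X`. -/
def GeneratesC0Semigroup (A : X →ₗ.[ℂ] X) : Prop :=
  ∃ T : ℝ≥0 → X →L[ℂ] X, IsC0Semigroup T ∧ IsGeneratorOf A T

/-- Uniform exponential stability: `‖T t‖ ≤ M e^{-δ t}` for some `M` and some `δ > 0`. -/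
def IsUniformlyExpStable (T : ℝ≥0 → X →L[ℂ] X) : Prop :=
  ∃ M δ : ℝ, 0 < δ ∧ ∀ t : ℝ≥0, ‖T t‖ ≤ M * Real.exp (-δ * t)

/-- The resolvent set `ρ(A)`: all `z` such that `z - A : D(A) → X` has a bounded, everywhere
defined, two-sided inverse `R`. -/
def resolventSet (A : X →ₗ.[ℂ] X) : Set ℂ :=
  {z | ∃ R : X →L[ℂ] X,
    (∀ x, ∃ h : R x ∈ A.domain, z • R x - A ⟨R x, h⟩ = x) ∧
    ∀ x : A.domain, R (z • (x : X) - A x) = x}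

end Semigroups

/-! ### Boundary nodes -/

section BoundaryNodes

variable {X : Type*} [NormedAddCommGroup X] [InnerProductSpace ℂ X]
variable {U : Type*} [NormedAddCommGroup U] [InnerProductSpace ℂ U]

/-- The restriction `A` of `L` to `Ker G`, where `G` is defined on `D(L)`. -/
def restrictKer (L : X →ₗ.[ℂ] X) (G : L.domain →ₗ[ℂ] U) : X →ₗ.[ℂ] X :=
  L.domRestrict ((LinearMap.ker G).map L.domain.subtype)

/-- The triple `(G, L, K)` is a boundary node on `(U, X, U)`. The domain `D(L)` carries the graph
norm, here in the form `‖x‖ + ‖L x‖`. -/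
structure IsBoundaryNode (L : X →ₗ.[ℂ] X) (G K : L.domain →ₗ[ℂ] U) : Prop where
  bounded_G : ∃ C : ℝ, ∀ x : L.domain, ‖G x‖ ≤ C * (‖(x : X)‖ + ‖L x‖)
  bounded_K : ∃ C : ℝ, ∀ x : L.domain, ‖K x‖ ≤ C * (‖(x : X)‖ + ‖L x‖)
  generates : GeneratesC0Semigroup (restrictKer L G)
  right_inverse : ∃ Gr : U →ₗ[ℂ] L.domain,
    (∃ C : ℝ, ∀ u, ‖(Gr u : X)‖ + ‖L (Gr u)‖ ≤ C * ‖u‖) ∧ ∀ u, G (Gr u) = u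

/-- An impedance passive boundary node: `Re ⟨L x, x⟩ ≤ Re ⟨G x, K x⟩` for all `x ∈ D(L)`. -/
structure IsImpedancePassiveBoundaryNode (L : X →ₗ.[ℂ] X) (G K : L.domain →ₗ[ℂ] U) : Prop
    extends IsBoundaryNode L G K where
  passive : ∀ x : L.domain, (inner ℂ (L x) (x : X)).re ≤ (inner ℂ (G x) (K x)).re

/-- `P` is the transfer function of `(G, L, K)`: for all `z ∈ ρ(A)` and all `u`, the problem
`(z - L) x = 0`, `G x = u` has a unique solution `x ∈ D(L)`, and `P(z) u = K x`. This determines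
`P` on `ρ(A)`; the values of `P` outside of `ρ(A)` are irrelevant. -/
def IsTransferFunction (L : X →ₗ.[ℂ] X) (G K : L.domain →ₗ[ℂ] U) (P : ℂ → U →L[ℂ] U) : Prop :=
  ∀ z ∈ resolventSet (restrictKer L G), ∀ u : U,
    ∃ x : L.domain, (z • (x : X) - L x = 0 ∧ G x = u) ∧
      (∀ y : L.domain, z • (y : X) - L y = 0 ∧ G y = u → y = x) ∧ P z u = K x

/-- The real part `Re T = (T + T*) / 2` of a bounded operator on a Hilbert space. -/
def rePart [CompleteSpace U] (T : U →L[ℂ] U) : U →L[ℂ] U :=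
  (2 : ℂ)⁻¹ • (T + ContinuousLinearMap.adjoint T)

end BoundaryNodes

/-! ### Sobolev spaces on the unit interval -/

/-- Lebesgue measure on `(0,1)`. -/
abbrev volI : Measure ℝ := volume.restrict (Ioo (0 : ℝ) 1)

/-- The complex Hilbert space `L²(0,1)`. -/
abbrev L2I : Type := Lp ℂ 2 volI

/-- (Real-valued) test functions on `(0,1)`. -/
structure IsTestFun (φ : ℝ → ℝ) : Prop where
  smooth : ContDiff ℝ ∞ φ
  compact : HasCompactSupport φ
  support : tsupport φ ⊆ Ioo 0 1

/-- `g` is the weak (distributional) derivative of `f` on `(0,1)`. -/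
def IsWeakDeriv (f g : L2I) : Prop :=
  ∀ φ : ℝ → ℝ, IsTestFun φ → ∫ x, deriv φ x • f x ∂volI = - ∫ x, φ x • g x ∂volI

/-- Membership in `H¹(0,1)`. -/
def MemH1 (f : L2I) : Prop := ∃ g, IsWeakDeriv f g

open Classical in
/-- The weak derivative `f' ∈ L²(0,1)` of `f ∈ H¹(0,1)` (and `0` for other `f`). -/
def weakDeriv (f : L2I) : L2I := if h : MemH1 f then h.choose else 0

/-- Membership in `H²(0,1)`: both `f` and its weak derivative `f'` lie in `H¹(0,1)`. -/
def MemH2 (f : L2I) : Prop := MemH1 f ∧ MemH1 (weakDeriv f)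

/-- `u` is a representative of `f` that is continuous on `[0,1]`. -/
def IsContRep (f : L2I) (u : ℝ → ℂ) : Prop := ContinuousOn u (Icc 0 1) ∧ f =ᵐ[volI] u

open Classical in
/-- The point value `f(a)`, `a ∈ [0,1]`, of `f ∈ H¹(0,1)`: the value at `a` of the continuous
representative of `f` (and `0` if there is no such representative). -/
def pointValue (a : ℝ) (f : L2I) : ℂ := if h : ∃ u, IsContRep f u then h.choose a else 0

/-! Elementary facts: weak derivatives and continuous representatives are unique, functions in
`H¹(0,1)` are the primitives of functions in `L²(0,1)`, and so `weakDeriv` and `pointValue` are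
linear on `H¹(0,1)`. -/

lemma integrable_coe (f : L2I) : Integrable f volI :=
  (Lp.memLp f).integrable (by norm_num)

lemma integrable_continuous_smul {ψ : ℝ → ℝ} (h1 : Continuous ψ) {f : ℝ → ℂ}
    (hf : Integrable f volI) : Integrable (fun x => ψ x • f x) volI := by
  obtain ⟨C, hC⟩ := (isCompact_Icc (a := (0 : ℝ)) (b := 1)).exists_bound_of_continuousOn
    h1.continuousOn
  refine hf.bdd_smul C h1.aestronglyMeasurable ?_
  filter_upwards [ae_restrict_mem measurableSet_Ioo] with x hx
  exact hC x (Ioo_subset_Icc_self hx)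

lemma IsTestFun.continuous_deriv {φ : ℝ → ℝ} (h : IsTestFun φ) : Continuous (deriv φ) :=
  h.smooth.continuous_deriv (by simp)

lemma IsTestFun.eq_zero {φ : ℝ → ℝ} (h : IsTestFun φ) {x : ℝ} (hx : x ∉ Ioo (0 : ℝ) 1) :
    φ x = 0 :=
  image_eq_zero_of_notMem_tsupport fun h' => hx (h.support h')

lemma ae_eq_of_test {f g : ℝ → ℂ} (hf : Integrable f volI) (hg : Integrable g volI)
    (h : ∀ φ, IsTestFun φ → ∫ x, φ x • f x ∂volI = ∫ x, φ x • g x ∂volI) : f =ᵐ[volI] g := by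
  have key : ∀ᵐ x, x ∈ Ioo (0 : ℝ) 1 → (f - g) x = 0 := by
    refine isOpen_Ioo.ae_eq_zero_of_integral_contDiff_smul_eq_zero
      (IntegrableOn.locallyIntegrableOn (hf.sub hg)) fun φ h1 h2 h3 => ?_
    have ht : IsTestFun φ := ⟨h1, h2, h3⟩
    have e : ∫ x, φ x • (f - g) x = ∫ x, φ x • (f - g) x ∂volI := by
      refine (setIntegral_eq_integral_of_forall_compl_eq_zero fun x hx => ?_).symm
      rw [ht.eq_zero hx, zero_smul]
    rw [e]
    simp only [Pi.sub_apply, smul_sub]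
    rw [integral_sub (integrable_continuous_smul h1.continuous hf)
      (integrable_continuous_smul h1.continuous hg), h φ ht, sub_self]
  have := (ae_restrict_iff' measurableSet_Ioo).2 key
  filter_upwards [this] with x hx
  exact sub_eq_zero.1 hx

/-- Integration by parts against a primitive. -/
lemma integral_deriv_smul_primitive {g : ℝ → ℂ} (hg : Integrable g volI) {φ : ℝ → ℝ}
    (hφ : IsTestFun φ) :
    ∫ x, deriv φ x • (∫ t in (0 : ℝ)..x, g t) ∂volI = - ∫ x, φ x • g x ∂volI := by
  have hd := hφ.continuous_deriv
  let F : ℝ → ℝ → ℂ := fun x t => (Iio x).indicator (fun t => deriv φ x • g t) t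
  have e1 : ∀ x ∈ Ioo (0 : ℝ) 1,
      deriv φ x • (∫ t in (0 : ℝ)..x, g t) = ∫ t, F x t ∂volI := by
    intro x hx
    simp only [F]
    rw [integral_indicator measurableSet_Iio, Measure.restrict_restrict measurableSet_Iio,
      integral_smul, intervalIntegral.integral_of_le hx.1.le, integral_Ioc_eq_integral_Ioo]
    congr 3
    ext t
    simp only [mem_Ioo, mem_inter_iff, mem_Iio]
    constructor
    · rintro ⟨h1, h2⟩
      exact ⟨h2, h1, h2.trans hx.2⟩
    · rintro ⟨h1, h2, -⟩
      exact ⟨h2, h1⟩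
  have e2 : ∀ t ∈ Ioo (0 : ℝ) 1, ∫ x, F x t ∂volI = -(φ t • g t) := by
    intro t ht
    have : ∀ x, F x t = (Ioi t).indicator (fun x => deriv φ x • g t) x := by
      intro x
      simp only [F, indicator_apply, mem_Iio, mem_Ioi]
    simp_rw [this]
    rw [integral_indicator measurableSet_Ioi, Measure.restrict_restrict measurableSet_Ioi,
      integral_smul_const]
    have hs : Ioi t ∩ Ioo 0 1 = Ioo t 1 := by
      ext x
      simp only [mem_Ioo, mem_inter_iff, mem_Ioi]
      constructor
      · rintro ⟨h1, -, h2⟩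
        exact ⟨h1, h2⟩
      · rintro ⟨h1, h2⟩
        exact ⟨h1, ht.1.trans h1, h2⟩
    rw [hs, ← integral_Ioc_eq_integral_Ioo, ← intervalIntegral.integral_of_le ht.2.le,
      intervalIntegral.integral_deriv_eq_sub (fun x _ => hφ.smooth.differentiable (by simp) x)
        (hd.intervalIntegrable _ _), hφ.eq_zero (x := 1) (by simp), zero_sub, neg_smul]
  have hint : Integrable (Function.uncurry F) (volI.prod volI) := by
    have h0 : Integrable (fun p : ℝ × ℝ => deriv φ p.1 • g p.2) (volI.prod volI) := by
      refine Integrable.smul_prod (f := deriv φ) ?_ hg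
      have := integrable_continuous_smul hd (f := fun _ => 1) (integrable_const 1)
      simpa using this.re
    have : Function.uncurry F =
        {p : ℝ × ℝ | p.2 < p.1}.indicator (fun p : ℝ × ℝ => deriv φ p.1 • g p.2) := by
      ext ⟨x, t⟩
      simp [F, Function.uncurry, indicator_apply]
    rw [this]
    exact h0.indicator (measurableSet_lt measurable_snd measurable_fst)
  calc ∫ x, deriv φ x • (∫ t in (0 : ℝ)..x, g t) ∂volI
      = ∫ x, ∫ t, F x t ∂volI ∂volI := setIntegral_congr_fun measurableSet_Ioo e1
    _ = ∫ t, ∫ x, F x t ∂volI ∂volI := integral_integral_swap hint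
    _ = ∫ t, -(φ t • g t) ∂volI := setIntegral_congr_fun measurableSet_Ioo e2
    _ = _ := integral_neg _

/-- A test function with mean zero is the derivative of a test function. -/
lemma IsTestFun.exists_primitive {θ : ℝ → ℝ} (hθ : IsTestFun θ) (h0 : ∫ x in (0 : ℝ)..1, θ x = 0) :
    ∃ φ, IsTestFun φ ∧ deriv φ = θ := by
  have hc := hθ.smooth.continuous
  let φ : ℝ → ℝ := fun x => ∫ t in (0 : ℝ)..x, θ t
  have hder : ∀ x, HasDerivAt φ (θ x) x := fun x =>
    intervalIntegral.integral_hasDerivAt_right (hc.intervalIntegrable _ _)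
      hc.stronglyMeasurable.stronglyMeasurableAtFilter hc.continuousAt
  have hd : deriv φ = θ := funext fun x => (hder x).deriv
  have hsm : ContDiff ℝ ∞ φ := by
    refine contDiff_infty_iff_deriv.2 ⟨fun x => (hder x).differentiableAt, ?_⟩
    rw [hd]
    exact hθ.smooth
  -- the support of `θ` lies in some `[a, b] ⊆ (0,1)`
  obtain ⟨a, b, ha, hb, hab, hK⟩ : ∃ a b : ℝ, 0 < a ∧ b < 1 ∧ a ≤ b ∧ tsupport θ ⊆ Icc a b := by
    rcases (tsupport θ).eq_empty_or_nonempty with he | hne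
    · exact ⟨1 / 2, 1 / 2, by norm_num, by norm_num, le_rfl, by simp [he]⟩
    · have hcp : IsCompact (tsupport θ) := hθ.compact
      have h1 := hθ.support (hcp.sInf_mem hne)
      have h2 := hθ.support (hcp.sSup_mem hne)
      refine ⟨sInf (tsupport θ), sSup (tsupport θ), h1.1, h2.2, ?_, fun x hx =>
        ⟨csInf_le hcp.bddBelow hx, le_csSup hcp.bddAbove hx⟩⟩
      exact csInf_le hcp.bddBelow (hcp.sSup_mem hne)
  have hz : ∀ x, x ∉ Icc a b → θ x = 0 := fun x hx =>
    image_eq_zero_of_notMem_tsupport fun h' => hx (hK h')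
  have hφz : ∀ x, x ∉ Icc a b → φ x = 0 := by
    intro x hx
    by_cases h : x < a
    · refine intervalIntegral.integral_zero_ae (Eventually.of_forall fun t ht => hz t ?_)
      intro h'
      rcases le_total 0 x with h3 | h3
      · rw [uIoc_of_le h3] at ht
        linarith [ht.2, h'.1]
      · rw [uIoc_of_ge h3] at ht
        linarith [ht.2, h'.1]
    · have hbx : b < x := by
        by_contra h'
        exact hx ⟨not_lt.1 h, not_lt.1 h'⟩
      have h1 : φ x = (∫ t in (0 : ℝ)..1, θ t) + ∫ t in (1 : ℝ)..x, θ t :=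
        (intervalIntegral.integral_add_adjacent_intervals (hc.intervalIntegrable _ _)
          (hc.intervalIntegrable _ _)).symm
      rw [h1, h0, zero_add]
      refine intervalIntegral.integral_zero_ae (Eventually.of_forall fun t ht => hz t ?_)
      intro h'
      rcases le_total 1 x with h3 | h3
      · rw [uIoc_of_le h3] at ht
        linarith [ht.1, h'.2]
      · rw [uIoc_of_ge h3] at ht
        linarith [ht.1, h'.2]
  have hsub : tsupport φ ⊆ Icc a b :=
    closure_minimal (fun x hx => by_contra fun h' => hx (hφz x h')) isClosed_Icc
  exact ⟨φ, ⟨hsm, HasCompactSupport.intro isCompact_Icc hφz,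
    hsub.trans (Icc_subset_Ioo ha hb)⟩, hd⟩

lemma exists_testFun : ∃ ψ, IsTestFun ψ ∧ ∫ x in (0 : ℝ)..1, ψ x = 1 := by
  let f : ContDiffBump (1 / 2 : ℝ) := ⟨1 / 8, 1 / 4, by norm_num, by norm_num⟩
  have ht : IsTestFun (f.normed volume) := by
    refine ⟨f.contDiff_normed, f.hasCompactSupport_normed, ?_⟩
    rw [f.tsupport_normed_eq, Real.closedBall_eq_Icc]
    exact Icc_subset_Ioo (by norm_num [f]) (by norm_num [f])
  refine ⟨_, ht, ?_⟩
  rw [intervalIntegral.integral_of_le zero_le_one, integral_Ioc_eq_integral_Ioo,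
    setIntegral_eq_integral_of_forall_compl_eq_zero fun x hx => ht.eq_zero hx]
  exact f.integral_normed

/-- A function whose weak derivative vanishes is constant. -/
lemma ae_eq_const_of_test {f : ℝ → ℂ} (hf : Integrable f volI)
    (h : ∀ φ, IsTestFun φ → ∫ x, deriv φ x • f x ∂volI = 0) : ∃ c : ℂ, f =ᵐ[volI] fun _ => c := by
  obtain ⟨ψ, hψ, hψ1⟩ := exists_testFun
  refine ⟨∫ x, ψ x • f x ∂volI, ae_eq_of_test hf (integrable_const _) fun θ hθ => ?_⟩
  set m : ℝ := ∫ x in (0 : ℝ)..1, θ x with hm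
  have ht : IsTestFun (fun x => θ x - m * ψ x) := by
    refine ⟨hθ.smooth.sub (contDiff_const.mul hψ.smooth), ?_, ?_⟩
    · exact hθ.compact.sub hψ.compact.mul_left
    · exact (tsupport_sub _ _).trans
        (union_subset hθ.support ((tsupport_mul_subset_right).trans hψ.support))
  obtain ⟨φ, hφ, hd⟩ := ht.exists_primitive (by
    have hi : IntervalIntegrable (fun x => m * ψ x) volume 0 1 :=
      (continuous_const.mul hψ.smooth.continuous).intervalIntegrable _ _
    rw [intervalIntegral.integral_sub (hθ.smooth.continuous.intervalIntegrable _ _) hi,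
      intervalIntegral.integral_const_mul, hψ1, mul_one, sub_self])
  have h1 := h φ hφ
  rw [hd] at h1
  simp only [sub_smul, mul_smul] at h1
  have hi : Integrable (fun x => m • ψ x • f x) volI :=
    (integrable_continuous_smul hψ.smooth.continuous hf).smul m
  rw [integral_sub (integrable_continuous_smul hθ.smooth.continuous hf) hi, integral_smul,
    sub_eq_zero] at h1
  rw [h1, integral_smul_const, hm, intervalIntegral.integral_of_le zero_le_one,
    integral_Ioc_eq_integral_Ioo]

lemma continuousOn_primitive {g : ℝ → ℂ} (hg : Integrable g volI) :
    ContinuousOn (fun x => ∫ t in (0 : ℝ)..x, g t) (Icc 0 1) := by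
  have h : IntegrableOn g (uIcc 0 1) volume := by
    rw [uIcc_of_le zero_le_one, integrableOn_Icc_iff_integrableOn_Ioo]
    exact hg
  have := intervalIntegral.continuousOn_primitive_interval h
  rwa [uIcc_of_le zero_le_one] at this

/-- `g` is the weak derivative of `f` if and only if `f(x) = c + ∫₀ˣ g` for almost every `x`. -/
lemma isWeakDeriv_iff {f g : L2I} :
    IsWeakDeriv f g ↔ ∃ c : ℂ, f =ᵐ[volI] fun x => c + ∫ t in (0 : ℝ)..x, g t := by
  have hg := integrable_coe g
  have hp : Integrable (fun x => ∫ t in (0 : ℝ)..x, g t) volI :=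
    ((continuousOn_primitive hg).integrableOn_compact isCompact_Icc).mono_set Ioo_subset_Icc_self
  constructor
  · intro h
    obtain ⟨c, hc⟩ := ae_eq_const_of_test ((integrable_coe f).sub hp) fun φ hφ => by
      simp only [Pi.sub_apply, smul_sub]
      rw [integral_sub (integrable_continuous_smul hφ.continuous_deriv (integrable_coe f))
        (integrable_continuous_smul hφ.continuous_deriv hp), h φ hφ,
        integral_deriv_smul_primitive hg hφ, sub_self]
    refine ⟨c, ?_⟩
    filter_upwards [hc] with x hx
    rw [← hx, Pi.sub_apply, sub_add_cancel]
  · rintro ⟨c, hc⟩ φ hφ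
    have e : ∫ x, deriv φ x • f x ∂volI =
        ∫ x, (deriv φ x • c + deriv φ x • ∫ t in (0 : ℝ)..x, g t) ∂volI := by
      refine integral_congr_ae ?_
      filter_upwards [hc] with x hx
      rw [hx, smul_add]
    have h0 : ∫ x, deriv φ x ∂volI = 0 := by
      rw [← integral_Ioc_eq_integral_Ioo, ← intervalIntegral.integral_of_le zero_le_one,
        intervalIntegral.integral_deriv_eq_sub (fun x _ => hφ.smooth.differentiable (by simp) x)
          (hφ.continuous_deriv.intervalIntegrable _ _), hφ.eq_zero (x := 1) (by simp),
        hφ.eq_zero (x := 0) (by simp), sub_self]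
    rw [e, integral_add (integrable_continuous_smul hφ.continuous_deriv (integrable_const c))
      (integrable_continuous_smul hφ.continuous_deriv hp), integral_smul_const, h0, zero_smul,
      zero_add, integral_deriv_smul_primitive hg hφ]

lemma IsWeakDeriv.unique {f g g' : L2I} (h : IsWeakDeriv f g) (h' : IsWeakDeriv f g') :
    g = g' := by
  refine Lp.ext (ae_eq_of_test (integrable_coe g) (integrable_coe g') fun φ hφ => ?_)
  exact neg_injective ((h φ hφ).symm.trans (h' φ hφ))

lemma MemH1.isWeakDeriv {f : L2I} (h : MemH1 f) : IsWeakDeriv f (weakDeriv f) := by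
  rw [weakDeriv, dif_pos h]
  exact h.choose_spec

lemma IsWeakDeriv.memH1 {f g : L2I} (h : IsWeakDeriv f g) : MemH1 f := ⟨g, h⟩

lemma IsWeakDeriv.weakDeriv_eq {f g : L2I} (h : IsWeakDeriv f g) : weakDeriv f = g :=
  h.memH1.isWeakDeriv.unique h

lemma IsWeakDeriv.add {f f' g g' : L2I} (h : IsWeakDeriv f g) (h' : IsWeakDeriv f' g') :
    IsWeakDeriv (f + f') (g + g') := by
  intro φ hφ
  have e (ψ : ℝ → ℝ) (hψ : Continuous ψ) (a b : L2I) : ∫ x, ψ x • (a + b : L2I) x ∂volI =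
      ∫ x, ψ x • a x ∂volI + ∫ x, ψ x • b x ∂volI := by
    rw [← integral_add (integrable_continuous_smul hψ (integrable_coe a))
      (integrable_continuous_smul hψ (integrable_coe b))]
    refine integral_congr_ae ?_
    filter_upwards [Lp.coeFn_add a b] with x hx
    rw [hx, Pi.add_apply, smul_add]
  rw [e _ hφ.continuous_deriv, e _ hφ.smooth.continuous, h φ hφ, h' φ hφ, neg_add]

lemma IsWeakDeriv.smul {f g : L2I} (c : ℂ) (h : IsWeakDeriv f g) :
    IsWeakDeriv (c • f) (c • g) := by
  intro φ hφ
  have e (ψ : ℝ → ℝ) (a : L2I) : ∫ x, ψ x • (c • a : L2I) x ∂volI =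
      c • ∫ x, ψ x • a x ∂volI := by
    rw [← integral_smul]
    refine integral_congr_ae ?_
    filter_upwards [Lp.coeFn_smul c a] with x hx
    rw [hx, Pi.smul_apply, smul_comm]
  rw [e, e, h φ hφ, smul_neg]

lemma isWeakDeriv_zero : IsWeakDeriv 0 0 := by
  have h : IsWeakDeriv ((0 : ℂ) • (0 : L2I)) ((0 : ℂ) • (0 : L2I)) := by
    intro φ hφ
    have e (ψ : ℝ → ℝ) : ∫ x, ψ x • ((0 : ℂ) • (0 : L2I) : L2I) x ∂volI = 0 := by
      rw [zero_smul]
      refine integral_eq_zero_of_ae ?_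
      filter_upwards [Lp.coeFn_zero ℂ 2 volI] with x hx
      rw [hx, Pi.zero_apply, smul_zero]
    rw [e, e, neg_zero]
  simpa using h

lemma memH1_zero : MemH1 0 := isWeakDeriv_zero.memH1

lemma MemH1.add {f g : L2I} (hf : MemH1 f) (hg : MemH1 g) : MemH1 (f + g) :=
  (hf.isWeakDeriv.add hg.isWeakDeriv).memH1

lemma MemH1.smul {f : L2I} (c : ℂ) (hf : MemH1 f) : MemH1 (c • f) :=
  (hf.isWeakDeriv.smul c).memH1

lemma weakDeriv_zero : weakDeriv 0 = 0 := isWeakDeriv_zero.weakDeriv_eq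

lemma weakDeriv_add {f g : L2I} (hf : MemH1 f) (hg : MemH1 g) :
    weakDeriv (f + g) = weakDeriv f + weakDeriv g :=
  (hf.isWeakDeriv.add hg.isWeakDeriv).weakDeriv_eq

lemma weakDeriv_smul {f : L2I} (c : ℂ) (hf : MemH1 f) : weakDeriv (c • f) = c • weakDeriv f :=
  (hf.isWeakDeriv.smul c).weakDeriv_eq

lemma memH2_zero : MemH2 0 := ⟨memH1_zero, by rw [weakDeriv_zero]; exact memH1_zero⟩

lemma MemH2.add {f g : L2I} (hf : MemH2 f) (hg : MemH2 g) : MemH2 (f + g) :=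
  ⟨hf.1.add hg.1, by rw [weakDeriv_add hf.1 hg.1]; exact hf.2.add hg.2⟩

lemma MemH2.smul {f : L2I} (c : ℂ) (hf : MemH2 f) : MemH2 (c • f) :=
  ⟨hf.1.smul c, by rw [weakDeriv_smul c hf.1]; exact hf.2.smul c⟩

lemma MemH1.exists_isContRep {f : L2I} (hf : MemH1 f) : ∃ u, IsContRep f u := by
  obtain ⟨c, hc⟩ := isWeakDeriv_iff.1 hf.isWeakDeriv
  exact ⟨_, continuousOn_const.add (continuousOn_primitive (integrable_coe _)), hc⟩

lemma IsContRep.pointValue_eq {f : L2I} {u : ℝ → ℂ} (h : IsContRep f u) {a : ℝ}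
    (ha : a ∈ Icc (0 : ℝ) 1) : pointValue a f = u a := by
  have hex : ∃ u, IsContRep f u := ⟨u, h⟩
  rw [pointValue, dif_pos hex]
  have hs := hex.choose_spec
  have e : hex.choose =ᵐ[volI] u := hs.2.symm.trans h.2
  refine Measure.eqOn_Icc_of_ae_eq volume zero_ne_one ?_ hs.1 h.1 ha
  rwa [Measure.restrict_congr_set Ioo_ae_eq_Icc.symm]

lemma pointValue_zero {a : ℝ} (ha : a ∈ Icc (0 : ℝ) 1) : pointValue a 0 = 0 :=
  IsContRep.pointValue_eq (u := fun _ => 0) ⟨continuousOn_const, Lp.coeFn_zero ℂ 2 volI⟩ ha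

lemma pointValue_add {f g : L2I} (hf : MemH1 f) (hg : MemH1 g) {a : ℝ}
    (ha : a ∈ Icc (0 : ℝ) 1) : pointValue a (f + g) = pointValue a f + pointValue a g := by
  obtain ⟨u, hu⟩ := hf.exists_isContRep
  obtain ⟨v, hv⟩ := hg.exists_isContRep
  rw [hu.pointValue_eq ha, hv.pointValue_eq ha]
  exact IsContRep.pointValue_eq (u := u + v)
    ⟨hu.1.add hv.1, (Lp.coeFn_add f g).trans (hu.2.add hv.2)⟩ ha

lemma pointValue_smul {f : L2I} (c : ℂ) (hf : MemH1 f) {a : ℝ}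
    (ha : a ∈ Icc (0 : ℝ) 1) : pointValue a (c • f) = c * pointValue a f := by
  obtain ⟨u, hu⟩ := hf.exists_isContRep
  rw [hu.pointValue_eq ha]
  exact IsContRep.pointValue_eq (u := c • u)
    ⟨hu.1.const_smul c, (Lp.coeFn_smul c f).trans (hu.2.const_smul c)⟩ ha

lemma zero_mem_I : (0 : ℝ) ∈ Icc (0 : ℝ) 1 := ⟨le_rfl, zero_le_one⟩

lemma one_mem_I : (1 : ℝ) ∈ Icc (0 : ℝ) 1 := ⟨zero_le_one, le_rfl⟩

/-! ### The heat network -/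

/-- The state space `X₂ = L²(0,1)³`. The components `w₁, w₂, w₃` have the indices `0, 1, 2`. -/
abbrev X₂ : Type := PiLp 2 fun _ : Fin 3 => L2I

/-- The input and output space `ℂ³`, with the Euclidean norm. -/
abbrev U₂ : Type := EuclideanSpace ℂ (Fin 3)

/-- `D(L₂) = {w ∈ H²(0,1)³ : w₃(1) = w₁(0), w₁(1) = w₂(0), w₂(1) = w₃(0)}`. -/
def domL₂ : Submodule ℂ X₂ where
  carrier := {w | (∀ k, MemH2 (w k)) ∧ pointValue 1 (w 2) = pointValue 0 (w 0) ∧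
    pointValue 1 (w 0) = pointValue 0 (w 1) ∧ pointValue 1 (w 1) = pointValue 0 (w 2)}
  zero_mem' := by
    refine ⟨fun k => memH2_zero, ?_, ?_, ?_⟩ <;>
      exact (pointValue_zero one_mem_I).trans (pointValue_zero zero_mem_I).symm
  add_mem' := by
    rintro v w ⟨hv, h1, h2, h3⟩ ⟨hw, h1', h2', h3'⟩
    refine ⟨fun k => (hv k).add (hw k), ?_, ?_, ?_⟩
    all_goals
      simp only [PiLp.add_apply]
      rw [pointValue_add (hv _).1 (hw _).1 one_mem_I, pointValue_add (hv _).1 (hw _).1 zero_mem_I]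
    · rw [h1, h1']
    · rw [h2, h2']
    · rw [h3, h3']
  smul_mem' := by
    rintro c w ⟨hw, h1, h2, h3⟩
    refine ⟨fun k => (hw k).smul c, ?_, ?_, ?_⟩
    all_goals
      simp only [PiLp.smul_apply]
      rw [pointValue_smul c (hw _).1 one_mem_I, pointValue_smul c (hw _).1 zero_mem_I]
    · rw [h1]
    · rw [h2]
    · rw [h3]

/-- `L₂ (w₁, w₂, w₃) = (β₁ w₁'', β₂ w₂'', β₃ w₃'')` with domain `D(L₂)`. -/
def L₂ (β : Fin 3 → ℝ) : X₂ →ₗ.[ℂ] X₂ where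
  domain := domL₂
  toFun :=
    { toFun := fun w => WithLp.toLp 2 fun k => (β k : ℂ) • weakDeriv (weakDeriv ((w : X₂) k))
      map_add' := by
        intro v w
        ext1 k
        have hv := v.2.1 k
        have hw := w.2.1 k
        simp only [Submodule.coe_add, PiLp.add_apply]
        rw [weakDeriv_add hv.1 hw.1, weakDeriv_add hv.2 hw.2, smul_add]
      map_smul' := by
        intro c w
        ext1 k
        have hw := w.2.1 k
        simp only [Submodule.coe_smul, PiLp.smul_apply, RingHom.id_apply]
        rw [weakDeriv_smul c hw.1, weakDeriv_smul c hw.2, smul_comm] }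

/-- `G₂ (w₁, w₂, w₃) = (w₁(0), w₂(0), w₃(0))`. -/
def G₂ (β : Fin 3 → ℝ) : (L₂ β).domain →ₗ[ℂ] U₂ where
  toFun := fun w => WithLp.toLp 2 fun k => pointValue 0 ((w : X₂) k)
  map_add' := by
    intro v w
    ext k
    exact pointValue_add (v.2.1 k).1 (w.2.1 k).1 zero_mem_I
  map_smul' := by
    intro c w
    ext k
    exact pointValue_smul c (w.2.1 k).1 zero_mem_I

/-- `K₂ (w₁, w₂, w₃) = (β₃ w₃'(1) - β₁ w₁'(0), β₁ w₁'(1) - β₂ w₂'(0), β₂ w₂'(1) - β₃ w₃'(0))`. -/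
def K₂ (β : Fin 3 → ℝ) : (L₂ β).domain →ₗ[ℂ] U₂ where
  toFun := fun w =>
    !₂[β 2 * pointValue 1 (weakDeriv ((w : X₂) 2)) - β 0 * pointValue 0 (weakDeriv ((w : X₂) 0)),
      β 0 * pointValue 1 (weakDeriv ((w : X₂) 0)) - β 1 * pointValue 0 (weakDeriv ((w : X₂) 1)),
      β 1 * pointValue 1 (weakDeriv ((w : X₂) 1)) - β 2 * pointValue 0 (weakDeriv ((w : X₂) 2))]
  map_add' := by
    intro v w
    have e (k : Fin 3) {a : ℝ} (ha : a ∈ Icc (0 : ℝ) 1) :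
        pointValue a (weakDeriv ((v : X₂) k + (w : X₂) k)) =
          pointValue a (weakDeriv ((v : X₂) k)) + pointValue a (weakDeriv ((w : X₂) k)) := by
      rw [weakDeriv_add (v.2.1 k).1 (w.2.1 k).1, pointValue_add (v.2.1 k).2 (w.2.1 k).2 ha]
    ext k
    fin_cases k <;> simp [e _ zero_mem_I, e _ one_mem_I] <;> ring
  map_smul' := by
    intro c w
    have e (k : Fin 3) {a : ℝ} (ha : a ∈ Icc (0 : ℝ) 1) :
        pointValue a (weakDeriv (c • (w : X₂) k)) =
          c * pointValue a (weakDeriv ((w : X₂) k)) := by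
      rw [weakDeriv_smul c (w.2.1 k).1, pointValue_smul c (w.2.1 k).2 ha]
    ext k
    fin_cases k <;> simp [e _ zero_mem_I, e _ one_mem_I] <;> ring

/-- The restriction `A₂` of `L₂` to `Ker G₂`. -/
def A₂ (β : Fin 3 → ℝ) : X₂ →ₗ.[ℂ] X₂ := restrictKer (L₂ β) (G₂ β)

end HeatNetwork

end

/-!
On each edge of the network, `A₂` is a multiple `β_k` of the Dirichlet Laplacian. All of its theory
is reduced to the Volterra operator `V f = ∫₀ˣ f` on `L²(0,1)`: the functions in `H¹(0,1)` are
`c + V g`, with the weak derivative `g` and the boundary values `c` and `c + ⟨1, g⟩`, and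
integration by parts is the identity `V + V* = ⟨1, ·⟩ 1` (`inner_volterra_add`). Consequently the
Green operator of the Dirichlet problem is `V Q V*`, where `Q` is the orthogonal projection onto the
functions of mean zero, so that `(-A₂)⁻¹` is a bounded positive operator `R`.

This suffices for the statements on `A₂`, without any eigenfunction expansion: the semigroup is
`e^{-t/x}`, evaluated at `x = R` by the continuous functional calculus (`expNegInv`). The bounds
`‖(T(t) - 1) R‖ ≤ t` and `‖((T(t) - 1) R / t + 1) R‖ ≤ t` and the density of the range of `R` give
strong continuity and the generator; the spectrum of `R` lies in `[0, ‖R‖]`, whence exponential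
stability. For `Re z ≥ 0` the operator `1 + z R` is invertible and `(z - A₂)⁻¹ = R (1 + z R)⁻¹`.

For the transfer function, on the edge `k` the solution with boundary values `a, b` is
`(a sinh (q (1 - x)) + b sinh (q x)) / sinh q`, where `β_k q² = z`. This writes `⟨v, P₂(z) u⟩` as a
sum over the edges (`inner_transferFunction`). On the line `Re z = 1` one may choose
`Re q ≥ β_k^{-1/2}`, so that `coth q` and `1 / sinh q` are bounded and only `|q| ~ 1 + |s|^{1/2}`
remains. On the imaginary axis, `q = r (1 ± i)`, and the form of an edge has the eigenvalues
`β_k q tanh (q / 2)` and `β_k q coth (q / 2)`; their real parts are explicit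
and at least `β_k r (sinh r - r) / (cosh r + 1)` (`coercivity_le`), where the last factor increases
with `r`.
-/

noncomputable section

namespace HeatNetwork

/-! ### Semigroups generated by operators with a positive bounded inverse -/

section AbstractSemigroup

variable {X : Type*} [NormedAddCommGroup X] [InnerProductSpace ℂ X]

/-- `R = (-A)⁻¹` as an everywhere defined bounded operator. -/
structure IsNegInverse (A : X →ₗ.[ℂ] X) (R : X →L[ℂ] X) : Prop where
  apply_inv : ∀ y, ∃ h : R y ∈ A.domain, A ⟨R y, h⟩ = -y
  inv_apply : ∀ x : A.domain, R (A x) = -(x : X)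

lemma IsNegInverse.injective {A : X →ₗ.[ℂ] X} {R : X →L[ℂ] X} (h : IsNegInverse A R) :
    Function.Injective R := by
  intro x y hxy
  obtain ⟨hx, hx'⟩ := h.apply_inv x
  obtain ⟨hy, hy'⟩ := h.apply_inv y
  have : (⟨R x, hx⟩ : A.domain) = ⟨R y, hy⟩ := Subtype.ext hxy
  rw [this, hy'] at hx'
  exact (neg_injective hx').symm

lemma IsNegInverse.mem_graph {A : X →ₗ.[ℂ] X} {R : X →L[ℂ] X} (h : IsNegInverse A R) {x y : X} :
    (x, y) ∈ A.graph ↔ x = -R y := by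
  constructor
  · intro hxy
    obtain ⟨z, hz⟩ := (LinearPMap.mem_graph_iff A).1 hxy
    obtain ⟨h1, h2⟩ := hz
    simp only at h1 h2
    rw [← h1, ← h2, h.inv_apply, neg_neg]
  · rintro rfl
    obtain ⟨h1, h2⟩ := h.apply_inv (-y)
    refine (LinearPMap.mem_graph_iff A).2 ⟨⟨_, h1⟩, ?_, ?_⟩
    · simp
    · rw [h2, neg_neg]

/-- A bounded family of operators that converges to `0` pointwise on the dense range of some
operator converges to `0` strongly. -/
lemma tendsto_apply_of_denseRange {ι : Type*} {l : Filter ι} {B : ι → X →L[ℂ] X} {R : X →L[ℂ] X}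
    (hR : DenseRange R) {C : ℝ} (hC : ∀ᶠ i in l, ‖B i‖ ≤ C)
    (h : ∀ y, Tendsto (fun i => B i (R y)) l (𝓝 0)) (x : X) :
    Tendsto (fun i => B i x) l (𝓝 0) := by
  rw [Metric.tendsto_nhds]
  intro ε hε
  set C' := max C 0 + 1 with hC'
  have hC'0 : 0 < C' := by positivity
  obtain ⟨y, hy⟩ := hR.exists_dist_lt x (ε := ε / (2 * C')) (by positivity)
  filter_upwards [hC, (Metric.tendsto_nhds.1 (h y)) (ε / 2) (by positivity)] with i h1 h2
  rw [dist_zero_right] at h2 ⊢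
  have e : B i x = B i (x - R y) + B i (R y) := by rw [← map_add, sub_add_cancel]
  have h3 : ‖B i (x - R y)‖ ≤ C' * (ε / (2 * C')) := by
    refine (B i).le_of_opNorm_le_of_le (h1.trans ?_) ?_
    · rw [hC']
      linarith [le_max_left C 0]
    · rw [← dist_eq_norm]
      exact hy.le
  have h4 : C' * (ε / (2 * C')) = ε / 2 := by field_simp
  calc ‖B i x‖ ≤ ‖B i (x - R y)‖ + ‖B i (R y)‖ := by rw [e]; exact norm_add_le _ _
    _ < ε := by linarith

variable [CompleteSpace X]

lemma denseRange_of_isPositive {R : X →L[ℂ] X} (hR : R.IsPositive)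
    (hi : Function.Injective R) : DenseRange R := by
  have h1 : (LinearMap.range (R : X →ₗ[ℂ] X))ᗮ = ⊥ := by
    rw [ContinuousLinearMap.orthogonal_range, hR.isSelfAdjoint.adjoint_eq]
    exact LinearMap.ker_eq_bot.2 hi
  have h2 := (Submodule.topologicalClosure_eq_top_iff).2 h1
  have h3 := (Submodule.dense_iff_topologicalClosure_eq_top).2 h2
  exact h3

lemma spectrum_nonneg_of_isPositive {R : X →L[ℂ] X} (hR : R.IsPositive) {x : ℝ}
    (hx : x ∈ spectrum ℝ R) : 0 ≤ x :=
  hR.spectrumRestricts.rightInvOn hx ▸ NNReal.coe_nonneg _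

lemma isUnit_one_add_smul {R : X →L[ℂ] X} (hR : R.IsPositive) {z : ℂ} (hz : 0 ≤ z.re) :
    IsUnit (1 + z • R) := by
  rcases eq_or_ne z 0 with rfl | h0
  · simp
  have h1 : -z⁻¹ ∉ spectrum ℂ R := by
    intro h
    have h2 := hR.isSelfAdjoint.spectrumRestricts.rightInvOn h
    have h3 : (-z⁻¹).re ∈ spectrum ℝ R := by
      rw [← hR.isSelfAdjoint.spectrumRestricts.image]
      exact ⟨_, h, rfl⟩
    have h4 := spectrum_nonneg_of_isPositive hR h3
    have h5 : (-z⁻¹).im = 0 := by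
      rw [← h2]
      simp
    have h7 : 0 < Complex.normSq z := Complex.normSq_pos.2 h0
    rw [Complex.neg_re, Complex.inv_re] at h4
    rw [Complex.neg_im, Complex.inv_im] at h5
    have h6 : z.re / Complex.normSq z = 0 := le_antisymm (by linarith) (by positivity)
    have h8 : z.re = 0 := by
      rcases div_eq_zero_iff.1 h6 with h | h
      · exact h
      · exact absurd h h7.ne'
    have h9 : z.im = 0 := by
      have : z.im / Complex.normSq z = 0 := by
        rw [neg_div, neg_neg] at h5
        exact h5
      rcases div_eq_zero_iff.1 this with h | h
      · exact h
      · exact absurd h h7.ne'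
    exact h0 (Complex.ext h8 h9)
  rw [spectrum.notMem_iff] at h1
  have e : 1 + z • R = -((Units.mk0 z h0) • (algebraMap ℂ (X →L[ℂ] X) (-z⁻¹) - R)) := by
    rw [Units.smul_def, Units.val_mk0, smul_sub, Algebra.algebraMap_eq_smul_one, smul_smul,
      mul_neg, mul_inv_cancel₀ h0]
    module
  rw [e]
  exact (h1.smul _).neg

/-- The closed right half plane belongs to the resolvent set:
`(z - A)⁻¹ = R (1 + z R)⁻¹` for `R = (-A)⁻¹`. -/
lemma IsNegInverse.mem_resolventSet {A : X →ₗ.[ℂ] X} {R : X →L[ℂ] X} (h : IsNegInverse A R)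
    (hR : R.IsPositive) {z : ℂ} (hz : 0 ≤ z.re) : z ∈ resolventSet A := by
  obtain ⟨Q, hQ⟩ := isUnit_one_add_smul hR hz
  have h1 : ∀ x, (Q⁻¹.val : X →L[ℂ] X) x + z • R (Q⁻¹.val x) = x := fun x => by
    have : ((1 + z • R) * Q⁻¹.val) x = x := by rw [← hQ, Q.mul_inv]; rfl
    simpa using this
  have h2 : ∀ x, Q⁻¹.val (x + z • R x) = x := fun x => by
    have : (Q⁻¹.val * (1 + z • R)) x = x := by rw [← hQ, Q.inv_mul]; rfl
    simpa using this
  refine ⟨R * Q⁻¹.val, fun x => ?_, fun x => ?_⟩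
  · obtain ⟨h3, h4⟩ := h.apply_inv (Q⁻¹.val x)
    refine ⟨h3, ?_⟩
    have := h1 x
    simp only [mul_apply_eq_comp]
    rw [h4, sub_neg_eq_add, add_comm]
    exact this
  · have h3 : (x : X) = R (-A x) := by rw [map_neg, h.inv_apply, neg_neg]
    have h4 : z • (x : X) - A x = -A x + z • R (-A x) := by rw [← h3]; abel
    rw [h4, mul_apply_eq_comp, h2, ← h3]

/-- The function `x ↦ e^{-t/x}` for `x > 0`, extended by `0` to `x ≤ 0`. -/
def expNegDiv (t x : ℝ) : ℝ := expNegInvGlue (x / t)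

lemma expNegDiv_zero (t : ℝ) : expNegDiv t 0 = 0 := by
  simp [expNegDiv, expNegInvGlue.zero]

lemma expNegDiv_of_pos {t x : ℝ} (ht : 0 < t) (hx : 0 < x) :
    expNegDiv t x = Real.exp (-(t / x)) := by
  have : ¬ x / t ≤ 0 := not_le.2 (by positivity)
  rw [expNegDiv, expNegInvGlue, if_neg this, inv_div]

lemma continuous_expNegDiv (t : ℝ) : Continuous (expNegDiv t) :=
  (expNegInvGlue.contDiff (n := 0)).continuous.comp (continuous_id.div_const t)

/-- The operator `e^{-t R⁻¹}` for a positive injective operator `R`, given by the continuous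
functional calculus of `R`. The value at `t = 0` is set to `1`. -/
def expNegInv (R : X →L[ℂ] X) (t : ℝ≥0) : X →L[ℂ] X :=
  if t = 0 then 1 else cfc (expNegDiv t) R

lemma expNegInv_of_pos (R : X →L[ℂ] X) {t : ℝ≥0} (ht : 0 < t) :
    expNegInv R t = cfc (expNegDiv t) R := if_neg ht.ne'

lemma expNegInv_zero (R : X →L[ℂ] X) : expNegInv R 0 = 1 := if_pos rfl

lemma expNegInv_add {R : X →L[ℂ] X} (hR : R.IsPositive) (s t : ℝ≥0) :
    expNegInv R (s + t) = expNegInv R s * expNegInv R t := by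
  rcases eq_or_ne s 0 with rfl | hs
  · rw [zero_add, expNegInv_zero, one_mul]
  rcases eq_or_ne t 0 with rfl | ht
  · rw [add_zero, expNegInv_zero, mul_one]
  have hs' : 0 < s := pos_iff_ne_zero.2 hs
  have ht' : 0 < t := pos_iff_ne_zero.2 ht
  rw [expNegInv_of_pos R hs', expNegInv_of_pos R ht', expNegInv_of_pos R (by positivity),
    ← cfc_mul _ _ R (continuous_expNegDiv _).continuousOn (continuous_expNegDiv _).continuousOn]
  refine cfc_congr fun x hx => ?_
  rcases (spectrum_nonneg_of_isPositive hR hx).eq_or_lt with rfl | h0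
  · simp [expNegDiv_zero]
  · have h1 : (0 : ℝ) < s := hs'
    have h2 : (0 : ℝ) < t := ht'
    have h3 : (0 : ℝ) < (s + t : ℝ≥0) := by positivity
    rw [expNegDiv_of_pos h1 h0, expNegDiv_of_pos h2 h0, expNegDiv_of_pos h3 h0, ← Real.exp_add]
    congr 1
    push_cast
    ring

lemma expNegInv_commute {R : X →L[ℂ] X} (hR : R.IsPositive) (t : ℝ≥0) :
    expNegInv R t * R = R * expNegInv R t := by
  rcases eq_or_ne t 0 with rfl | ht
  · rw [expNegInv_zero, one_mul, mul_one]
  rw [expNegInv_of_pos R (pos_iff_ne_zero.2 ht)]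
  have := hR.isSelfAdjoint
  have h : Commute (cfc (expNegDiv t) R) (cfc (fun x : ℝ => x) R) := cfc_commute_cfc _ _ R
  rw [cfc_id' ℝ R] at h
  exact h

/-- The spectrum of `R` lies in `[0, ‖R‖]`, so `e^{-t/x} ≤ e^{-t/(‖R‖+1)}` there. -/
lemma norm_expNegInv_le {R : X →L[ℂ] X} (hR : R.IsPositive) (t : ℝ≥0) :
    ‖expNegInv R t‖ ≤ Real.exp (-(‖R‖ + 1)⁻¹ * t) := by
  rcases eq_or_ne t 0 with rfl | ht
  · rw [expNegInv_zero]
    rw [NNReal.coe_zero, mul_zero, Real.exp_zero]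
    exact ContinuousLinearMap.norm_id_le
  have ht' : (0 : ℝ) < t := NNReal.coe_pos.2 (pos_iff_ne_zero.2 ht)
  rw [expNegInv_of_pos R ht']
  refine norm_cfc_le (Real.exp_pos _).le fun x hx => ?_
  rcases (spectrum_nonneg_of_isPositive hR hx).eq_or_lt with rfl | h0
  · rw [expNegDiv_zero, norm_zero]
    exact (Real.exp_pos _).le
  · rw [expNegDiv_of_pos ht' h0, Real.norm_of_nonneg (Real.exp_pos _).le, Real.exp_le_exp]
    have h1 : x ≤ ‖R‖ * ‖(1 : X →L[ℂ] X)‖ :=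
      (le_abs_self x).trans (spectrum.norm_le_norm_mul_of_mem hx)
    have h2 : x ≤ ‖R‖ + 1 := by
      have : ‖(1 : X →L[ℂ] X)‖ ≤ 1 := ContinuousLinearMap.norm_id_le
      nlinarith [norm_nonneg R]
    rw [neg_mul, neg_le_neg_iff, inv_mul_eq_div]
    gcongr

lemma norm_expNegInv_mul_sub_le {R : X →L[ℂ] X} (hR : R.IsPositive) (t : ℝ≥0) :
    ‖expNegInv R t * R - R‖ ≤ t := by
  rcases eq_or_ne t 0 with rfl | ht
  · simp [expNegInv_zero]
  have ht' : (0 : ℝ) < t := NNReal.coe_pos.2 (pos_iff_ne_zero.2 ht)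
  have hs := hR.isSelfAdjoint
  have hc := (continuous_expNegDiv t).continuousOn (s := spectrum ℝ R)
  have hid : ContinuousOn (fun x : ℝ => x) (spectrum ℝ R) := continuousOn_id
  have hm : ContinuousOn (fun x : ℝ => expNegDiv t x * x) (spectrum ℝ R) := hc.mul hid
  have e : expNegInv R t * R - R = cfc (fun x => expNegDiv t x * x - x) R := by
    rw [cfc_sub _ _ R hm hid, cfc_mul _ _ R hc hid, cfc_id' ℝ R,
      expNegInv_of_pos R ht']
  rw [e]
  refine norm_cfc_le ht'.le fun x hx => ?_
  rcases (spectrum_nonneg_of_isPositive hR hx).eq_or_lt with rfl | h0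
  · simp
  · rw [expNegDiv_of_pos ht' h0]
    have h1 := Real.add_one_le_exp (-(t / x))
    have h2 : Real.exp (-(t / x)) ≤ 1 := Real.exp_le_one_iff.2 (by simp; positivity)
    have h3 : (t / x) * x = t := by field_simp
    rw [Real.norm_eq_abs, abs_le]
    constructor <;> nlinarith

lemma norm_inv_smul_expNegInv_sub_mul_sq_add_le {R : X →L[ℂ] X} (hR : R.IsPositive) {t : ℝ≥0}
    (ht : 0 < t) :
    ‖((t : ℝ)⁻¹ • (expNegInv R t * R - R) + 1) * R‖ ≤ t := by
  have ht' : (0 : ℝ) < t := ht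
  have hs := hR.isSelfAdjoint
  have hc := (continuous_expNegDiv t).continuousOn (s := spectrum ℝ R)
  have hid : ContinuousOn (fun x : ℝ => x) (spectrum ℝ R) := continuousOn_id
  have hm : ContinuousOn (fun x : ℝ => expNegDiv t x * x) (spectrum ℝ R) := hc.mul hid
  have hc' : ContinuousOn (fun x : ℝ => expNegDiv t x * x - x) (spectrum ℝ R) :=
    hm.sub hid
  have hc'' : ContinuousOn (fun x : ℝ => (t : ℝ)⁻¹ * (expNegDiv t x * x - x)) (spectrum ℝ R) :=
    continuousOn_const.mul hc'
  have e : ((t : ℝ)⁻¹ • (expNegInv R t * R - R) + 1) * R =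
      cfc (fun x => ((t : ℝ)⁻¹ * (expNegDiv t x * x - x) + 1) * x) R := by
    rw [cfc_mul (fun x => (t : ℝ)⁻¹ * (expNegDiv t x * x - x) + 1) _ R
      (hc''.add continuousOn_const) hid, cfc_add R _ (fun _ => 1) hc'' continuousOn_const,
      cfc_const_one ℝ R, cfc_const_mul _ _ R hc', cfc_sub _ _ R hm hid,
      cfc_mul _ _ R hc hid, cfc_id' ℝ R, expNegInv_of_pos R ht']
  rw [e]
  refine norm_cfc_le ht'.le fun x hx => ?_
  rcases (spectrum_nonneg_of_isPositive hR hx).eq_or_lt with rfl | h0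
  · simp
  · rw [expNegDiv_of_pos ht' h0]
    -- with `s = t / x`, the claim is `0 ≤ e^{-s} - 1 + s ≤ s²`
    set s := (t : ℝ) / x with hs
    have hs0 : 0 < s := by positivity
    have h1 := Real.add_one_le_exp (-s)
    have h2 : Real.exp (-s) ≤ 1 - s + s ^ 2 := by
      have h3 := Real.add_one_le_exp s
      have h4 : Real.exp (-s) ≤ (s + 1)⁻¹ := by
        rw [Real.exp_neg]
        gcongr
      refine h4.trans ?_
      rw [inv_le_iff_one_le_mul₀ (by positivity)]
      nlinarith [pow_pos hs0 3]
    have hx' : x = t / s := by rw [hs]; field_simp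
    have h5 : ((t : ℝ)⁻¹ * (Real.exp (-s) * x - x) + 1) * x =
        (Real.exp (-s) - 1 + s) * (t / s ^ 2) := by
      rw [hx']
      field_simp
    rw [h5, Real.norm_eq_abs, abs_of_nonneg (mul_nonneg (by linarith) (by positivity))]
    calc (Real.exp (-s) - 1 + s) * ((t : ℝ) / s ^ 2) ≤ s ^ 2 * ((t : ℝ) / s ^ 2) := by
          gcongr; linarith
      _ = (t : ℝ) := by field_simp

theorem isC0Semigroup_expNegInv {R : X →L[ℂ] X} (hR : R.IsPositive)
    (hi : Function.Injective R) : IsC0Semigroup (expNegInv R) := by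
  refine ⟨expNegInv_zero R, expNegInv_add hR, fun x => ?_⟩
  have h1 := tendsto_apply_of_denseRange (l := 𝓝 (0 : ℝ≥0)) (B := fun t => expNegInv R t - 1)
    (denseRange_of_isPositive hR hi) (C := 2) (Eventually.of_forall fun t => ?_) (fun y => ?_) x
  · have := h1.add_const x
    simpa using this
  · have h2 : ‖expNegInv R t‖ ≤ 1 := (norm_expNegInv_le hR t).trans <| by
      rw [Real.exp_le_one_iff, neg_mul, neg_nonpos]
      positivity
    have h3 : ‖(1 : X →L[ℂ] X)‖ ≤ 1 := ContinuousLinearMap.norm_id_le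
    calc _ ≤ ‖expNegInv R t‖ + ‖(1 : X →L[ℂ] X)‖ := norm_sub_le _ _
      _ ≤ 2 := by linarith
  · refine squeeze_zero_norm (a := fun t : ℝ≥0 => (t : ℝ) * ‖y‖) (fun t => ?_) ?_
    · exact (expNegInv R t * R - R).le_of_opNorm_le (norm_expNegInv_mul_sub_le hR t) y
    · have : Tendsto (fun t : ℝ≥0 => (t : ℝ) * ‖y‖) (𝓝 0) (𝓝 (((0 : ℝ≥0) : ℝ) * ‖y‖)) :=
        (NNReal.continuous_coe.tendsto 0).mul_const _
      simpa using this

/-- The difference quotients `(T(t)R - R)/t` are bounded by `1` and converge to `-1` on the range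
of `R`, hence strongly. -/
lemma tendsto_diffQuotient_expNegInv {R : X →L[ℂ] X} (hR : R.IsPositive)
    (hi : Function.Injective R) (x : X) :
    Tendsto (fun t : ℝ≥0 => (((t : ℝ) : ℂ)⁻¹) • (expNegInv R t (R x) - R x)) (𝓝[>] 0)
      (𝓝 (-x)) := by
  have h1 := tendsto_apply_of_denseRange (l := 𝓝[>] (0 : ℝ≥0))
    (B := fun t => (t : ℝ)⁻¹ • (expNegInv R t * R - R) + 1)
    (denseRange_of_isPositive hR hi) (C := 2) ?_ (fun y => ?_) x
  · have := h1.add_const (-x)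
    rw [zero_add] at this
    refine this.congr fun t => ?_
    have e : (((t : ℝ) : ℂ)⁻¹) • (expNegInv R t (R x) - R x) =
        (t : ℝ)⁻¹ • (expNegInv R t (R x) - R x) := by
      rw [← Complex.ofReal_inv, Complex.coe_smul]
    rw [e]
    simp
  · filter_upwards [self_mem_nhdsWithin] with t ht
    have ht' : (0 : ℝ) < t := ht
    have h3 : ‖(1 : X →L[ℂ] X)‖ ≤ 1 := ContinuousLinearMap.norm_id_le
    have h4 : ‖(t : ℝ)⁻¹ • (expNegInv R t * R - R)‖ ≤ 1 := by
      rw [norm_smul, Real.norm_of_nonneg (by positivity), inv_mul_le_iff₀ ht', mul_one]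
      exact norm_expNegInv_mul_sub_le hR t
    exact (norm_add_le _ _).trans (by linarith)
  · refine squeeze_zero_norm' (a := fun t : ℝ≥0 => (t : ℝ) * ‖y‖) ?_ ?_
    · filter_upwards [self_mem_nhdsWithin] with t ht
      exact ContinuousLinearMap.le_of_opNorm_le _
        (norm_inv_smul_expNegInv_sub_mul_sq_add_le hR ht) y
    · have : Tendsto (fun t : ℝ≥0 => (t : ℝ) * ‖y‖) (𝓝 0) (𝓝 (((0 : ℝ≥0) : ℝ) * ‖y‖)) :=
        (NNReal.continuous_coe.tendsto 0).mul_const _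
      simpa using this.mono_left nhdsWithin_le_nhds

theorem isGeneratorOf_expNegInv {A : X →ₗ.[ℂ] X} {R : X →L[ℂ] X} (h : IsNegInverse A R)
    (hR : R.IsPositive) : IsGeneratorOf A (expNegInv R) := by
  intro x y
  rw [h.mem_graph]
  constructor
  · rintro rfl
    simpa using tendsto_diffQuotient_expNegInv hR h.injective (-y)
  · -- apply `R`, which commutes with the semigroup, to the difference quotients
    intro hxy
    have h1 := (R.continuous.tendsto y).comp hxy
    have h2 := tendsto_diffQuotient_expNegInv hR h.injective x
    have h3 : R y = -x := by
      refine tendsto_nhds_unique h1 (h2.congr fun t => ?_)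
      have h4 : expNegInv R t (R x) = R (expNegInv R t x) :=
        congrArg (fun B : X →L[ℂ] X => B x) (expNegInv_commute hR t)
      simp [h4]
    rw [h3, neg_neg]

lemma isUniformlyExpStable_expNegInv {R : X →L[ℂ] X} (hR : R.IsPositive) :
    IsUniformlyExpStable (expNegInv R) :=
  ⟨1, (‖R‖ + 1)⁻¹, by positivity, fun t => by rw [one_mul]; exact norm_expNegInv_le hR t⟩

end AbstractSemigroup

/-! ### Restrictions to the kernel and transfer functions -/

section TransferFunction

variable {X : Type*} [NormedAddCommGroup X] [InnerProductSpace ℂ X]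
variable {U : Type*} [NormedAddCommGroup U] [InnerProductSpace ℂ U]
variable {L : X →ₗ.[ℂ] X} {G : L.domain →ₗ[ℂ] U}

lemma mem_domain_restrictKer {x : X} :
    x ∈ (restrictKer L G).domain ↔ ∃ h : x ∈ L.domain, G ⟨x, h⟩ = 0 := by
  simp [restrictKer, LinearPMap.domRestrict_domain]

lemma restrictKer_apply (x : (restrictKer L G).domain) (h : (x : X) ∈ L.domain) :
    restrictKer L G x = L ⟨x, h⟩ :=
  LinearPMap.domRestrict_apply rfl

lemma eq_of_mem_resolventSet {z : ℂ} (hz : z ∈ resolventSet (restrictKer L G)) {x y : L.domain}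
    (hx : z • (x : X) - L x = 0) (hy : z • (y : X) - L y = 0) (h : G x = G y) : x = y := by
  obtain ⟨R, -, hR⟩ := hz
  have h1 : ((x - y : L.domain) : X) ∈ (restrictKer L G).domain :=
    mem_domain_restrictKer.2 ⟨(x - y).2, by rw [Subtype.coe_eta, map_sub, h, sub_self]⟩
  have h2 := hR ⟨_, h1⟩
  rw [restrictKer_apply _ (x - y).2, Subtype.coe_eta, LinearPMap.map_sub] at h2
  have e : z • ((x - y : L.domain) : X) - (L x - L y) = 0 := by
    rw [Submodule.coe_sub, smul_sub, ← sub_eq_zero.1 hx, ← sub_eq_zero.1 hy]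
    abel
  rw [e, map_zero] at h2
  exact sub_eq_zero.1 (Subtype.ext h2.symm)

/-- For a right inverse `Gr` of `G`, the solution of `(z - L) x = 0`, `G x = u` is
`Gr u - (z - A)⁻¹ (z - L) Gr u`. On a finite dimensional input space its dependence on `u` is
automatically bounded. -/
lemma exists_isTransferFunction [FiniteDimensional ℂ U] (K : L.domain →ₗ[ℂ] U)
    (Gr : U →ₗ[ℂ] L.domain) (hGr : ∀ u, G (Gr u) = u) :
    ∃ P : ℂ → U →L[ℂ] U, IsTransferFunction L G K P := by
  have key : ∀ z ∈ resolventSet (restrictKer L G), ∃ S : U →ₗ[ℂ] L.domain,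
      ∀ u, z • (S u : X) - L (S u) = 0 ∧ G (S u) = u := by
    rintro z ⟨R, hR, -⟩
    let D : U →ₗ[ℂ] X := z • L.domain.subtype ∘ₗ Gr - L.toFun ∘ₗ Gr
    have hD : ∀ u, D u = z • (Gr u : X) - L (Gr u) := fun u => rfl
    have hmem : ∀ u, R (D u) ∈ L.domain := fun u =>
      (mem_domain_restrictKer.1 (hR (D u)).1).1
    let E : U →ₗ[ℂ] L.domain := LinearMap.codRestrict L.domain ((R : X →ₗ[ℂ] X) ∘ₗ D) hmem
    refine ⟨Gr - E, fun u => ?_⟩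
    obtain ⟨h1, h2⟩ := hR (D u)
    obtain ⟨h3, h4⟩ := mem_domain_restrictKer.1 h1
    have hE : E u = ⟨R (D u), h3⟩ := rfl
    rw [restrictKer_apply _ h3] at h2
    simp only at h2
    constructor
    · rw [LinearMap.sub_apply, LinearPMap.map_sub, hE, Submodule.coe_sub, smul_sub]
      simp only
      rw [sub_sub_sub_comm, ← hD, h2, sub_self]
    · rw [LinearMap.sub_apply, map_sub, hGr, hE, h4, sub_zero]
  choose S hS using key
  classical
  refine ⟨fun z => if hz : z ∈ resolventSet (restrictKer L G) then
    LinearMap.toContinuousLinearMap (K ∘ₗ S z hz) else 0, fun z hz u => ?_⟩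
  refine ⟨S z hz u, hS z hz u, fun y hy => ?_, ?_⟩
  · exact eq_of_mem_resolventSet hz hy.1 (hS z hz u).1 (hy.2.trans (hS z hz u).2.symm)
  · simp only [dif_pos hz]
    rfl

end TransferFunction

/-! ### The Volterra operator on `L²(0,1)` -/

instance : IsProbabilityMeasure volI := ⟨by simp⟩

lemma memLp_of_continuousOn {u : ℝ → ℂ} (hu : ContinuousOn u (Icc 0 1)) : MemLp u 2 volI := by
  obtain ⟨C, hC⟩ := isCompact_Icc.exists_bound_of_continuousOn hu
  refine MemLp.of_bound ((hu.mono Ioo_subset_Icc_self).aestronglyMeasurable measurableSet_Ioo) C ?_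
  filter_upwards [ae_restrict_mem measurableSet_Ioo] with x hx
  exact hC x (Ioo_subset_Icc_self hx)

lemma integral_volI (f : ℝ → ℂ) : ∫ x, f x ∂volI = ∫ x in (0 : ℝ)..1, f x := by
  rw [intervalIntegral.integral_of_le zero_le_one, integral_Ioc_eq_integral_Ioo]

lemma intervalIntegrable_of_volI {f : ℝ → ℂ} (hf : Integrable f volI) {x : ℝ}
    (hx : x ∈ Icc (0 : ℝ) 1) : IntervalIntegrable f volume 0 x := by
  rw [intervalIntegrable_iff_integrableOn_Ioo_of_le hx.1]
  exact hf.mono_measure (Measure.restrict_mono_set _ (Ioo_subset_Ioo_right hx.2))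

lemma integral_norm_le_norm (f : L2I) : ∫ x, ‖f x‖ ∂volI ≤ ‖f‖ := by
  have h1 : eLpNorm f 1 volI ≤ eLpNorm f 2 volI :=
    eLpNorm_le_eLpNorm_of_exponent_le (by norm_num) (Lp.aestronglyMeasurable f)
  rw [Lp.norm_def]
  refine le_trans (le_of_eq ?_) (ENNReal.toReal_mono (Lp.eLpNorm_ne_top f) h1)
  rw [eLpNorm_one_eq_lintegral_enorm,
    integral_norm_eq_lintegral_enorm (Lp.aestronglyMeasurable f)]

lemma norm_primitive_le (f : L2I) {x : ℝ} (hx : x ∈ Icc (0 : ℝ) 1) :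
    ‖∫ t in (0 : ℝ)..x, f t‖ ≤ ‖f‖ := by
  refine le_trans ?_ (integral_norm_le_norm f)
  rw [intervalIntegral.integral_of_le hx.1, integral_Ioc_eq_integral_Ioo]
  refine (norm_integral_le_integral_norm _).trans ?_
  exact integral_mono_measure (Measure.restrict_mono_set _ (Ioo_subset_Ioo_right hx.2))
    (Eventually.of_forall fun _ => norm_nonneg _) (integrable_coe f).norm

/-- The primitive `x ↦ ∫₀ˣ f` as an element of `L²(0,1)`. -/
def primitiveLp (f : L2I) : L2I :=
  (memLp_of_continuousOn (continuousOn_primitive (integrable_coe f))).toLp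

lemma primitiveLp_ae (f : L2I) : primitiveLp f =ᵐ[volI] fun x => ∫ t in (0 : ℝ)..x, f t :=
  MemLp.coeFn_toLp _

lemma primitive_congr {f g : ℝ → ℂ} (h : f =ᵐ[volI] g) {x : ℝ} (hx : x ∈ Icc (0 : ℝ) 1) :
    ∫ t in (0 : ℝ)..x, f t = ∫ t in (0 : ℝ)..x, g t := by
  rw [intervalIntegral.integral_of_le hx.1, intervalIntegral.integral_of_le hx.1,
    integral_Ioc_eq_integral_Ioo, integral_Ioc_eq_integral_Ioo]
  exact integral_congr_ae (ae_mono (Measure.restrict_mono_set _ (Ioo_subset_Ioo_right hx.2)) h)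

/-- The Volterra operator `(V f)(x) = ∫₀ˣ f` on `L²(0,1)`. -/
def volterra : L2I →L[ℂ] L2I :=
  LinearMap.mkContinuous
    { toFun := primitiveLp
      map_add' := fun f g => by
        refine Lp.ext ?_
        filter_upwards [primitiveLp_ae (f + g), primitiveLp_ae f, primitiveLp_ae g,
          Lp.coeFn_add (primitiveLp f) (primitiveLp g), ae_restrict_mem measurableSet_Ioo]
          with x h1 h2 h3 h4 hx
        have hx' := Ioo_subset_Icc_self hx
        rw [h1, h4, Pi.add_apply, h2, h3, primitive_congr (Lp.coeFn_add f g) hx']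
        exact intervalIntegral.integral_add (intervalIntegrable_of_volI (integrable_coe f) hx')
          (intervalIntegrable_of_volI (integrable_coe g) hx')
      map_smul' := fun c f => by
        refine Lp.ext ?_
        filter_upwards [primitiveLp_ae (c • f), primitiveLp_ae f,
          Lp.coeFn_smul c (primitiveLp f), ae_restrict_mem measurableSet_Ioo]
          with x h1 h2 h4 hx
        rw [RingHom.id_apply, h1, h4, Pi.smul_apply, h2,
          primitive_congr (Lp.coeFn_smul c f) (Ioo_subset_Icc_self hx)]
        exact intervalIntegral.integral_smul c f } 1 fun f => by
    refine (Lp.norm_le_of_ae_bound (norm_nonneg f) ?_).trans (le_of_eq ?_)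
    · filter_upwards [primitiveLp_ae f, ae_restrict_mem measurableSet_Ioo] with x h1 hx
      simp only [LinearMap.coe_mk, AddHom.coe_mk]
      rw [h1]
      exact norm_primitive_le f (Ioo_subset_Icc_self hx)
    · simp [measureUnivNNReal]

lemma volterra_ae (f : L2I) : volterra f =ᵐ[volI] fun x => ∫ t in (0 : ℝ)..x, f t :=
  primitiveLp_ae f

/-- The constant function `1` as an element of `L²(0,1)`. -/
def oneLp : L2I := Lp.const 2 volI 1

lemma oneLp_ae : oneLp =ᵐ[volI] fun _ => (1 : ℂ) := Lp.coeFn_const 2 volI 1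

lemma inner_oneLp (f : L2I) : inner ℂ oneLp f = ∫ t in (0 : ℝ)..1, f t := by
  rw [L2.inner_def, ← integral_volI]
  refine integral_congr_ae ?_
  filter_upwards [oneLp_ae] with x hx
  rw [hx]
  simp

lemma inner_oneLp_oneLp : inner ℂ oneLp oneLp = 1 := by
  rw [inner_oneLp, primitive_congr oneLp_ae one_mem_I]
  simp

lemma norm_oneLp : ‖oneLp‖ = 1 := by
  rw [@norm_eq_sqrt_re_inner ℂ, inner_oneLp_oneLp]
  simp

lemma isContRep_add_volterra (c : ℂ) (g : L2I) :
    IsContRep (c • oneLp + volterra g) (fun x => c + ∫ t in (0 : ℝ)..x, g t) := by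
  refine ⟨continuousOn_const.add (continuousOn_primitive (integrable_coe g)), ?_⟩
  filter_upwards [Lp.coeFn_add (c • oneLp) (volterra g), Lp.coeFn_smul c oneLp, oneLp_ae,
    volterra_ae g] with x h1 h2 h3 h4
  rw [h1, Pi.add_apply, h2, Pi.smul_apply, h3, h4, smul_eq_mul, mul_one]

/-- Functions in `H¹(0,1)` have the form `c + V g`, where `g` is the weak derivative. -/
lemma isWeakDeriv_iff_volterra {f g : L2I} :
    IsWeakDeriv f g ↔ ∃ c : ℂ, f = c • oneLp + volterra g := by
  rw [isWeakDeriv_iff]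
  refine exists_congr fun c => ⟨fun h => ?_, ?_⟩
  · exact Lp.ext (h.trans (isContRep_add_volterra c g).2.symm)
  · rintro rfl
    exact (isContRep_add_volterra c g).2

lemma isWeakDeriv_add_volterra (c : ℂ) (g : L2I) : IsWeakDeriv (c • oneLp + volterra g) g :=
  isWeakDeriv_iff_volterra.2 ⟨c, rfl⟩

lemma pointValue_zero_add_volterra (c : ℂ) (g : L2I) :
    pointValue 0 (c • oneLp + volterra g) = c := by
  rw [(isContRep_add_volterra c g).pointValue_eq zero_mem_I]
  simp

lemma pointValue_one_add_volterra (c : ℂ) (g : L2I) :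
    pointValue 1 (c • oneLp + volterra g) = c + inner ℂ oneLp g := by
  rw [(isContRep_add_volterra c g).pointValue_eq one_mem_I, inner_oneLp]

lemma IsWeakDeriv.eq_add_volterra {f g : L2I} (h : IsWeakDeriv f g) :
    f = pointValue 0 f • oneLp + volterra g := by
  obtain ⟨c, rfl⟩ := isWeakDeriv_iff_volterra.1 h
  rw [pointValue_zero_add_volterra]

lemma IsWeakDeriv.pointValue_one {f g : L2I} (h : IsWeakDeriv f g) :
    pointValue 1 f = pointValue 0 f + inner ℂ oneLp g := by
  obtain ⟨c, rfl⟩ := isWeakDeriv_iff_volterra.1 h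
  rw [pointValue_zero_add_volterra, pointValue_one_add_volterra]

open BoundedContinuousFunction in
/-- Integration by parts, `V + V* = ⟨1, ·⟩ 1`. It holds for continuous functions by the fundamental
theorem of calculus, and these are dense. -/
lemma inner_volterra_add (f g : L2I) :
    inner ℂ (volterra f) g + inner ℂ f (volterra g) = inner ℂ f oneLp * inner ℂ oneLp g := by
  have hd := BoundedContinuousFunction.toLp_denseRange ℂ volI ℂ (p := 2) (by norm_num)
  refine hd.induction_on₂ (p := fun f g => inner ℂ (volterra f) g + inner ℂ f (volterra g) =
    inner ℂ f oneLp * inner ℂ oneLp g) ?_ ?_ f g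
  · exact isClosed_eq (by fun_prop) (by fun_prop)
  · intro u v
    set f : L2I := toLp 2 volI ℂ u
    set g : L2I := toLp 2 volI ℂ v
    have hf : f =ᵐ[volI] u := coeFn_toLp 2 volI ℂ u
    have hg : g =ᵐ[volI] v := coeFn_toLp 2 volI ℂ v
    have hder : ∀ (w : ℝ →ᵇ ℂ) (x : ℝ), HasDerivAt (fun x => ∫ t in (0 : ℝ)..x, w t) (w x) x :=
      fun w x => intervalIntegral.integral_hasDerivAt_right (w.continuous.intervalIntegrable _ _)
        w.continuous.stronglyMeasurable.stronglyMeasurableAtFilter w.continuous.continuousAt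
    have hder' : ∀ x, HasDerivAt (fun x => (starRingEnd ℂ) (∫ t in (0 : ℝ)..x, u t))
        ((starRingEnd ℂ) (u x)) x := fun x => (hder u x).star
    have h1 := intervalIntegral.integral_deriv_mul_eq_sub (a := 0) (b := 1)
      (fun x _ => hder' x) (fun x _ => hder v x)
      ((Complex.continuous_conj.comp u.continuous).intervalIntegrable _ _)
      (v.continuous.intervalIntegrable _ _)
    have h2 : inner ℂ oneLp g = ∫ t in (0 : ℝ)..1, v t := by
      rw [inner_oneLp, primitive_congr hg one_mem_I]
    have h3 : inner ℂ f oneLp = (starRingEnd ℂ) (∫ t in (0 : ℝ)..1, u t) := by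
      rw [← inner_conj_symm, inner_oneLp, primitive_congr hf one_mem_I]
    rw [h2, h3, L2.inner_def, L2.inner_def, ← integral_add (L2.integrable_inner _ _)
      (L2.integrable_inner _ _), ← sub_zero (_ * _)]
    simp only [intervalIntegral.integral_same, mul_zero] at h1
    rw [← h1, ← integral_volI]
    refine integral_congr_ae ?_
    filter_upwards [hf, hg, volterra_ae f, volterra_ae g, ae_restrict_mem measurableSet_Ioo]
      with x e1 e2 e3 e4 hx
    have hx' := Ioo_subset_Icc_self hx
    rw [e1, e2, e3, e4, primitive_congr hf hx', primitive_congr hg hx']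
    simp only [RCLike.inner_apply]
    ring

lemma adjoint_volterra_apply (f : L2I) :
    ContinuousLinearMap.adjoint volterra f = inner ℂ oneLp f • oneLp - volterra f := by
  refine ext_inner_left ℂ fun g => ?_
  rw [ContinuousLinearMap.adjoint_inner_right, inner_sub_right, inner_smul_right,
    eq_sub_iff_add_eq, inner_volterra_add, mul_comm]

/-- The function `x ↦ x` is not constant. -/
lemma volterra_oneLp_sub_ne_zero (c : ℂ) : volterra oneLp - c • oneLp ≠ 0 := by
  intro h
  have h1 : IsWeakDeriv ((-c) • oneLp + volterra oneLp) oneLp := isWeakDeriv_add_volterra _ _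
  have e : (-c) • oneLp + volterra oneLp = 0 := by rw [← h]; module
  rw [e] at h1
  have h2 := h1.unique isWeakDeriv_zero
  have h3 := norm_oneLp
  rw [h2, norm_zero] at h3
  exact zero_ne_one h3

/-! ### The inverse of the Dirichlet Laplacian -/

/-- The orthogonal projection onto the functions with mean zero. -/
def meanZeroProj : L2I →L[ℂ] L2I :=
  ContinuousLinearMap.id ℂ L2I - (innerSL ℂ oneLp).smulRight oneLp

lemma meanZeroProj_apply (f : L2I) : meanZeroProj f = f - inner ℂ oneLp f • oneLp := rfl

lemma isPositive_meanZeroProj : meanZeroProj.IsPositive := by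
  have h : ∀ f g : L2I, inner ℂ (meanZeroProj f) g =
      inner ℂ f g - inner ℂ f oneLp * inner ℂ oneLp g := fun f g => by
    rw [meanZeroProj_apply, inner_sub_left, inner_smul_left, inner_conj_symm]
  refine (ContinuousLinearMap.isPositive_def' ).2 ⟨?_, fun f => ?_⟩
  · refine (ContinuousLinearMap.isSelfAdjoint_iff_isSymmetric).2 fun f g => ?_
    simp only [ContinuousLinearMap.coe_coe]
    rw [h, meanZeroProj_apply, inner_sub_right, inner_smul_right, mul_comm]
  · have h1 : ‖inner ℂ oneLp f‖ ≤ ‖f‖ := by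
      simpa [norm_oneLp] using norm_inner_le_norm (𝕜 := ℂ) oneLp f
    have h2 : inner ℂ f oneLp * inner ℂ oneLp f = ((‖inner ℂ oneLp f‖ ^ 2 : ℝ) : ℂ) := by
      rw [← inner_conj_symm, Complex.conj_mul']
      push_cast
      rfl
    rw [ContinuousLinearMap.reApplyInnerSelf_apply, h, h2, map_sub, inner_self_eq_norm_sq]
    have h3 : RCLike.re (((‖inner ℂ oneLp f‖ ^ 2 : ℝ) : ℂ)) = ‖inner ℂ oneLp f‖ ^ 2 :=
      Complex.ofReal_re _
    rw [h3, sub_nonneg]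
    gcongr

/-- The Green operator `f ↦ w`, where `-w'' = f` and `w(0) = w(1) = 0`. -/
def greenOp : L2I →L[ℂ] L2I :=
  volterra ∘L meanZeroProj ∘L ContinuousLinearMap.adjoint volterra

lemma greenOp_apply (f : L2I) :
    greenOp f = volterra (inner ℂ oneLp (volterra f) • oneLp - volterra f) := by
  have h1 : meanZeroProj (inner ℂ oneLp f • oneLp - volterra f) =
      inner ℂ oneLp (volterra f) • oneLp - volterra f := by
    rw [meanZeroProj_apply, inner_sub_right, inner_smul_right, inner_oneLp_oneLp]
    module
  simp only [greenOp, ContinuousLinearMap.comp_apply]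
  rw [adjoint_volterra_apply, h1]

lemma isPositive_greenOp : greenOp.IsPositive := isPositive_meanZeroProj.conj_adjoint volterra

/-- `w = greenOp f` satisfies `w ∈ H²`, `-w'' = f` and `w(0) = w(1) = 0`. -/
lemma greenOp_spec (f : L2I) : MemH2 (greenOp f) ∧ weakDeriv (weakDeriv (greenOp f)) = -f ∧
    pointValue 0 (greenOp f) = 0 ∧ pointValue 1 (greenOp f) = 0 := by
  set c := inner ℂ oneLp (volterra f) with hc
  have e1 : greenOp f = (0 : ℂ) • oneLp + volterra (c • oneLp + volterra (-f)) := by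
    rw [greenOp_apply, map_neg, zero_smul, zero_add, sub_eq_add_neg]
  have h1 := isWeakDeriv_add_volterra 0 (c • oneLp + volterra (-f))
  have h2 := isWeakDeriv_add_volterra c (-f)
  rw [e1]
  refine ⟨⟨h1.memH1, ?_⟩, ?_, pointValue_zero_add_volterra _ _, ?_⟩
  · rw [h1.weakDeriv_eq]
    exact h2.memH1
  · rw [h1.weakDeriv_eq, h2.weakDeriv_eq]
  · rw [pointValue_one_add_volterra, inner_add_right, inner_smul_right, inner_oneLp_oneLp, map_neg,
      inner_neg_right, ← hc]
    ring

lemma greenOp_weakDeriv {w : L2I} (hw : MemH2 w) (h0 : pointValue 0 w = 0)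
    (h1 : pointValue 1 w = 0) : greenOp (weakDeriv (weakDeriv w)) = -w := by
  have e1 := hw.1.isWeakDeriv.eq_add_volterra
  have e2 := hw.2.isWeakDeriv.eq_add_volterra
  have e3 := hw.1.isWeakDeriv.pointValue_one
  set b := pointValue 0 (weakDeriv w)
  set f := weakDeriv (weakDeriv w)
  rw [h0, h1, zero_add, e2, inner_add_right, inner_smul_right, inner_oneLp_oneLp, mul_one] at e3
  rw [h0, zero_smul, zero_add, e2] at e1
  have e4 : inner ℂ oneLp (volterra f) = -b := by linear_combination -e3
  rw [greenOp_apply, e4, e1, ← map_neg]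
  congr 1
  module

/-- The operator `(f₁, f₂, f₃) ↦ (c₁ S f₁, c₂ S f₂, c₃ S f₃)` on `L²(0,1)³`. -/
def diagOp (c : Fin 3 → ℝ) (S : L2I →L[ℂ] L2I) : X₂ →L[ℂ] X₂ :=
  (PiLp.continuousLinearEquiv 2 ℂ fun _ : Fin 3 => L2I).symm.toContinuousLinearMap ∘L
    ContinuousLinearMap.pi fun k => (c k : ℂ) • (S ∘L PiLp.proj 2 (fun _ : Fin 3 => L2I) k)

lemma diagOp_apply (c : Fin 3 → ℝ) (S : L2I →L[ℂ] L2I) (x : X₂) (k : Fin 3) :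
    diagOp c S x k = (c k : ℂ) • S (x k) := rfl

lemma isPositive_diagOp {c : Fin 3 → ℝ} (hc : ∀ k, 0 ≤ c k) {S : L2I →L[ℂ] L2I}
    (hS : S.IsPositive) : (diagOp c S).IsPositive := by
  refine (ContinuousLinearMap.isPositive_def').2 ⟨?_, fun x => ?_⟩
  · refine (ContinuousLinearMap.isSelfAdjoint_iff_isSymmetric).2 fun x y => ?_
    simp only [ContinuousLinearMap.coe_coe, PiLp.inner_apply, diagOp_apply]
    refine Finset.sum_congr rfl fun k _ => ?_
    rw [inner_smul_left, inner_smul_right, Complex.conj_ofReal, hS.inner_left_eq_inner_right]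
  · rw [ContinuousLinearMap.reApplyInnerSelf_apply, PiLp.inner_apply, map_sum]
    refine Finset.sum_nonneg fun k _ => ?_
    rw [diagOp_apply, inner_smul_left, Complex.conj_ofReal]
    have := hS.re_inner_nonneg_left (x k)
    simp only [RCLike.re_to_complex, Complex.re_ofReal_mul] at this ⊢
    exact mul_nonneg (hc k) this

lemma L₂_apply {β : Fin 3 → ℝ} (x : (L₂ β).domain) (k : Fin 3) :
    L₂ β x k = (β k : ℂ) • weakDeriv (weakDeriv ((x : X₂) k)) := rfl

lemma G₂_apply {β : Fin 3 → ℝ} (x : (L₂ β).domain) (k : Fin 3) :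
    G₂ β x k = pointValue 0 ((x : X₂) k) := rfl

/-- The three couplings of the network in a uniform way, with indices modulo `3`. -/
lemma mem_domL₂ {x : X₂} : x ∈ domL₂ ↔
    (∀ k, MemH2 (x k)) ∧ ∀ k, pointValue 1 (x k) = pointValue 0 (x (k + 1)) := by
  refine and_congr_right fun _ => ?_
  rw [Fin.forall_fin_succ, Fin.forall_fin_two]
  exact ⟨fun h => ⟨h.2.1, h.2.2, h.1⟩, fun h => ⟨h.2.2, h.1, h.2.1⟩⟩

/-- The inverse of `-A₂`: on each edge the Green operator of the Dirichlet Laplacian. -/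
def invNegA₂ (β : Fin 3 → ℝ) : X₂ →L[ℂ] X₂ := diagOp (fun k => (β k)⁻¹) greenOp

lemma isPositive_invNegA₂ {β : Fin 3 → ℝ} (hβ : ∀ k, 0 < β k) : (invNegA₂ β).IsPositive :=
  isPositive_diagOp (fun k => inv_nonneg.2 (hβ k).le) isPositive_greenOp

lemma isNegInverse_invNegA₂ {β : Fin 3 → ℝ} (hβ : ∀ k, 0 < β k) :
    IsNegInverse (A₂ β) (invNegA₂ β) := by
  refine ⟨fun y => ?_, fun x => ?_⟩
  · have hs := fun k => greenOp_spec (y k)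
    have e0 : ∀ k, pointValue 0 (invNegA₂ β y k) = 0 := fun k => by
      rw [invNegA₂, diagOp_apply, pointValue_smul _ (hs k).1.1 zero_mem_I, (hs k).2.2.1, mul_zero]
    have e1 : ∀ k, pointValue 1 (invNegA₂ β y k) = 0 := fun k => by
      rw [invNegA₂, diagOp_apply, pointValue_smul _ (hs k).1.1 one_mem_I, (hs k).2.2.2, mul_zero]
    have h1 : invNegA₂ β y ∈ (L₂ β).domain := by
      refine mem_domL₂.2 ⟨fun k => (hs k).1.smul _, fun k => ?_⟩
      rw [e0, e1]
    have h2 : invNegA₂ β y ∈ (A₂ β).domain := by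
      refine mem_domain_restrictKer.2 ⟨h1, ?_⟩
      ext k
      exact e0 k
    refine ⟨h2, (restrictKer_apply (L := L₂ β) (G := G₂ β) ⟨_, h2⟩ h1).trans ?_⟩
    ext1 k
    rw [L₂_apply]
    simp only [invNegA₂, diagOp_apply, PiLp.neg_apply]
    rw [weakDeriv_smul _ (hs k).1.1, weakDeriv_smul _ (hs k).1.2, (hs k).2.1, smul_smul,
      Complex.ofReal_inv, mul_inv_cancel₀ (Complex.ofReal_ne_zero.2 (hβ k).ne'), one_smul]
  · obtain ⟨h1, h2⟩ := mem_domain_restrictKer.1 x.2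
    obtain ⟨h3, h4⟩ := mem_domL₂.1 h1
    have h5 : ∀ k, pointValue 0 ((x : X₂) k) = 0 := fun k => congrArg (fun u : U₂ => u k) h2
    have e : A₂ β x = L₂ β ⟨x, h1⟩ := restrictKer_apply (L := L₂ β) (G := G₂ β) x h1
    rw [e]
    ext1 k
    rw [invNegA₂, diagOp_apply, L₂_apply, map_smul, PiLp.neg_apply,
      greenOp_weakDeriv (h3 k) (h5 k) (by rw [h4, h5]), smul_smul, Complex.ofReal_inv,
      inv_mul_cancel₀ (Complex.ofReal_ne_zero.2 (hβ k).ne'), one_smul]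

/-! ### The boundary node -/

/-- Functions in `H²(0,1)` in terms of `w(0)`, `w'(0)` and `w''`. -/
lemma MemH2.eq_volterra {w : L2I} (hw : MemH2 w) :
    w = pointValue 0 w • oneLp + pointValue 0 (weakDeriv w) • volterra oneLp +
      volterra (volterra (weakDeriv (weakDeriv w))) := by
  conv_lhs => rw [hw.1.isWeakDeriv.eq_add_volterra, hw.2.isWeakDeriv.eq_add_volterra]
  rw [map_add, map_smul, add_assoc]

/-- The traces of `w` and `w'` are controlled by the graph norm of the second derivative: `w'(0)`
is read off from the projection of `w - V² w'' = w(0) + w'(0) x` to the functions of mean zero. -/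
lemma exists_norm_trace_le : ∃ C : ℝ, 0 ≤ C ∧ ∀ w : L2I, MemH2 w →
    ‖pointValue 0 w‖ ≤ C * (‖w‖ + ‖weakDeriv (weakDeriv w)‖) ∧
    ‖pointValue 0 (weakDeriv w)‖ ≤ C * (‖w‖ + ‖weakDeriv (weakDeriv w)‖) ∧
    ‖pointValue 1 (weakDeriv w)‖ ≤ C * (‖w‖ + ‖weakDeriv (weakDeriv w)‖) := by
  set d := ‖meanZeroProj (volterra oneLp)‖ with hd
  have hd0 : 0 < d := norm_pos_iff.2 (volterra_oneLp_sub_ne_zero _)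
  set p := ‖meanZeroProj‖
  set v := ‖volterra ∘L volterra‖
  set C₁ := d⁻¹ * (p * (1 + v)) with hC₁
  set C₂ := 1 + v + C₁ * ‖volterra oneLp‖ with hC₂
  have hp : 0 ≤ p := norm_nonneg _
  have hv : 0 ≤ v := norm_nonneg _
  have h1 : 0 ≤ C₁ := by positivity
  have h2 : 0 ≤ C₂ := by positivity
  refine ⟨C₁ + C₂ + 1, by positivity, fun w hw => ?_⟩
  have e := hw.eq_volterra
  have e' := hw.2.isWeakDeriv.pointValue_one
  set a := pointValue 0 w
  set b := pointValue 0 (weakDeriv w)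
  set f := weakDeriv (weakDeriv w)
  set N := ‖w‖ + ‖f‖ with hN
  have hw0 := norm_nonneg w
  have hf0 := norm_nonneg f
  have hN0 : 0 ≤ N := by positivity
  have hvf : ‖volterra (volterra f)‖ ≤ v * ‖f‖ := (volterra ∘L volterra).le_opNorm f
  have hwv : ‖w - volterra (volterra f)‖ ≤ (1 + v) * N := by
    refine (norm_sub_le _ _).trans ?_
    rw [hN]
    nlinarith [mul_nonneg hv hw0]
  have hP1 : meanZeroProj oneLp = 0 := by
    rw [meanZeroProj_apply, inner_oneLp_oneLp, one_smul, sub_self]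
  have hb : ‖b‖ ≤ C₁ * N := by
    have h3 : b • meanZeroProj (volterra oneLp) = meanZeroProj (w - volterra (volterra f)) := by
      conv_rhs =>
        rw [e, add_sub_cancel_right, map_add, map_smul, hP1, smul_zero, zero_add, map_smul]
    have h4 : ‖b‖ * d ≤ p * ((1 + v) * N) := by
      rw [hd, ← norm_smul, h3]
      exact meanZeroProj.le_opNorm_of_le hwv
    rw [hC₁, mul_assoc, ← div_eq_inv_mul, le_div_iff₀ hd0]
    linarith
  have ha : ‖a‖ ≤ C₂ * N := by
    have h3 : a • oneLp = (w - volterra (volterra f)) - b • volterra oneLp := by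
      conv_rhs => rw [e, add_sub_cancel_right, add_sub_cancel_right]
    have h4 : ‖a‖ = ‖a • oneLp‖ := by rw [norm_smul, norm_oneLp, mul_one]
    rw [h4, h3]
    refine (norm_sub_le _ _).trans ?_
    rw [norm_smul, hC₂]
    nlinarith [mul_le_mul_of_nonneg_right hb (norm_nonneg (volterra oneLp))]
  have hb' : ‖pointValue 1 (weakDeriv w)‖ ≤ (C₁ + 1) * N := by
    have h3 : ‖inner ℂ oneLp f‖ ≤ ‖f‖ := by
      simpa [norm_oneLp] using norm_inner_le_norm (𝕜 := ℂ) oneLp f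
    rw [e']
    refine (norm_add_le _ _).trans ?_
    rw [hN] at hb ⊢
    linarith
  have k1 := mul_nonneg h1 hN0
  have k2 := mul_nonneg h2 hN0
  refine ⟨?_, ?_, ?_⟩ <;> linarith

lemma norm_le_sum (u : U₂) : ‖u‖ ≤ ∑ k, ‖u k‖ := by
  rw [EuclideanSpace.norm_eq, Real.sqrt_le_left (by positivity), Fin.sum_univ_three,
    Fin.sum_univ_three]
  nlinarith [mul_nonneg (norm_nonneg (u 0)) (norm_nonneg (u 1)),
    mul_nonneg (norm_nonneg (u 0)) (norm_nonneg (u 2)),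
    mul_nonneg (norm_nonneg (u 1)) (norm_nonneg (u 2))]

/-- The node conditions of the output map in a uniform way; `k + 2 = k - 1` modulo `3`. -/
lemma K₂_apply {β : Fin 3 → ℝ} (x : (L₂ β).domain) (k : Fin 3) :
    K₂ β x k = β (k + 2) * pointValue 1 (weakDeriv ((x : X₂) (k + 2))) -
      β k * pointValue 0 (weakDeriv ((x : X₂) k)) := by
  fin_cases k <;> rfl

/-- The pairing with the output, as a sum over the edges of the network instead of the nodes. -/
lemma inner_K₂ {β : Fin 3 → ℝ} (u : U₂) (x : (L₂ β).domain) :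
    inner ℂ u (K₂ β x) = ∑ k, (β k : ℂ) *
      (starRingEnd ℂ (u (k + 1)) * pointValue 1 (weakDeriv ((x : X₂) k)) -
        starRingEnd ℂ (u k) * pointValue 0 (weakDeriv ((x : X₂) k))) := by
  simp only [PiLp.inner_apply, RCLike.inner_apply, K₂_apply, Fin.sum_univ_three]
  simp only [zero_add, show (1 : Fin 3) + 2 = 0 from rfl, show (2 : Fin 3) + 2 = 1 from rfl,
    show (1 : Fin 3) + 1 = 2 from rfl, show (2 : Fin 3) + 1 = 0 from rfl]
  ring

lemma exists_norm_edge_le {β : Fin 3 → ℝ} (hβ : ∀ k, 0 < β k) :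
    ∃ C : ℝ, 0 ≤ C ∧ ∀ (x : (L₂ β).domain) (k : Fin 3),
      ‖pointValue 0 ((x : X₂) k)‖ ≤ C * (‖(x : X₂)‖ + ‖L₂ β x‖) ∧
      ‖pointValue 0 (weakDeriv ((x : X₂) k))‖ ≤ C * (‖(x : X₂)‖ + ‖L₂ β x‖) ∧
      ‖pointValue 1 (weakDeriv ((x : X₂) k))‖ ≤ C * (‖(x : X₂)‖ + ‖L₂ β x‖) := by
  obtain ⟨C, hC, h⟩ := exists_norm_trace_le
  have hB : 0 ≤ ∑ k, (β k)⁻¹ := Finset.sum_nonneg fun k _ => inv_nonneg.2 (hβ k).le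
  refine ⟨C * (1 + ∑ k, (β k)⁻¹), by positivity, fun x k => ?_⟩
  have h1 := PiLp.norm_apply_le (x : X₂) k
  have h2 : ‖weakDeriv (weakDeriv ((x : X₂) k))‖ ≤ (∑ k, (β k)⁻¹) * ‖L₂ β x‖ := by
    have h3 := PiLp.norm_apply_le (L₂ β x) k
    rw [L₂_apply, norm_smul, Complex.norm_real, Real.norm_of_nonneg (hβ k).le,
      ← le_div_iff₀' (hβ k), div_eq_inv_mul] at h3
    refine h3.trans ?_
    gcongr
    exact Finset.single_le_sum (f := fun k => (β k)⁻¹) (fun j _ => inv_nonneg.2 (hβ j).le)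
      (Finset.mem_univ k)
  have h4 : C * (‖(x : X₂) k‖ + ‖weakDeriv (weakDeriv ((x : X₂) k))‖) ≤
      C * (1 + ∑ k, (β k)⁻¹) * (‖(x : X₂)‖ + ‖L₂ β x‖) := by
    rw [mul_assoc]
    refine mul_le_mul_of_nonneg_left ?_ hC
    nlinarith [mul_nonneg hB (norm_nonneg (x : X₂)), norm_nonneg (L₂ β x)]
  obtain ⟨h5, h6, h7⟩ := h _ (x.2.1 k)
  exact ⟨h5.trans h4, h6.trans h4, h7.trans h4⟩

lemma exists_norm_G₂_le {β : Fin 3 → ℝ} (hβ : ∀ k, 0 < β k) :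
    ∃ C : ℝ, ∀ x : (L₂ β).domain, ‖G₂ β x‖ ≤ C * (‖(x : X₂)‖ + ‖L₂ β x‖) := by
  obtain ⟨C, hC, h⟩ := exists_norm_edge_le hβ
  refine ⟨∑ _k : Fin 3, C, fun x => (norm_le_sum _).trans ?_⟩
  rw [Finset.sum_mul]
  exact Finset.sum_le_sum fun k _ => (h x k).1

lemma exists_norm_K₂_le {β : Fin 3 → ℝ} (hβ : ∀ k, 0 < β k) :
    ∃ C : ℝ, ∀ x : (L₂ β).domain, ‖K₂ β x‖ ≤ C * (‖(x : X₂)‖ + ‖L₂ β x‖) := by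
  obtain ⟨C, hC, h⟩ := exists_norm_edge_le hβ
  refine ⟨∑ k : Fin 3, (β (k + 2) * C + β k * C), fun x => (norm_le_sum _).trans ?_⟩
  rw [Finset.sum_mul]
  refine Finset.sum_le_sum fun k _ => ?_
  rw [K₂_apply, add_mul, mul_assoc, mul_assoc]
  refine (norm_sub_le _ _).trans ?_
  rw [norm_mul, norm_mul, Complex.norm_real, Complex.norm_real, Real.norm_of_nonneg (hβ _).le,
    Real.norm_of_nonneg (hβ _).le]
  exact add_le_add (mul_le_mul_of_nonneg_left (h x _).2.2 (hβ _).le)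
    (mul_le_mul_of_nonneg_left (h x _).2.1 (hβ _).le)

/-- Integration by parts on an edge. -/
lemma MemH2.inner_weakDeriv {w : L2I} (hw : MemH2 w) :
    inner ℂ (weakDeriv (weakDeriv w)) w =
      starRingEnd ℂ (pointValue 1 (weakDeriv w)) * pointValue 1 w -
      starRingEnd ℂ (pointValue 0 (weakDeriv w)) * pointValue 0 w -
      (‖weakDeriv w‖ : ℂ) ^ 2 := by
  have e1 := hw.1.isWeakDeriv.eq_add_volterra
  have e2 := hw.2.isWeakDeriv.eq_add_volterra
  have e3 := hw.1.isWeakDeriv.pointValue_one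
  have e4 := hw.2.isWeakDeriv.pointValue_one
  set a := pointValue 0 w
  set b := pointValue 0 (weakDeriv w)
  set g := weakDeriv w
  set f := weakDeriv g
  have h1 := inner_volterra_add f g
  have h2 : inner ℂ (volterra f) g = (‖g‖ : ℂ) ^ 2 - starRingEnd ℂ b * inner ℂ oneLp g := by
    have h3 : volterra f = g - b • oneLp := by
      rw [eq_sub_iff_add_eq, add_comm]
      exact e2.symm
    rw [h3, inner_sub_left, inner_smul_left, inner_self_eq_norm_sq_to_K]
    rfl
  have h4 : inner ℂ f oneLp = starRingEnd ℂ (pointValue 1 g) - starRingEnd ℂ b := by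
    rw [← inner_conj_symm, e4, map_add, add_sub_cancel_left]
  have h5 : inner ℂ f w = a * inner ℂ f oneLp + inner ℂ f (volterra g) := by
    conv_lhs => rw [e1, inner_add_right, inner_smul_right]
  rw [h5, e3]
  rw [h2, h4] at h1
  rw [h4]
  linear_combination h1

theorem re_inner_L₂_le {β : Fin 3 → ℝ} (hβ : ∀ k, 0 < β k) (x : (L₂ β).domain) :
    (inner ℂ (L₂ β x) (x : X₂)).re ≤ (inner ℂ (G₂ β x) (K₂ β x)).re := by
  obtain ⟨h1, h2⟩ := mem_domL₂.1 x.2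
  rw [inner_K₂, PiLp.inner_apply, Complex.re_sum, Complex.re_sum]
  refine Finset.sum_le_sum fun k _ => ?_
  rw [L₂_apply, inner_smul_left, Complex.conj_ofReal, (h1 k).inner_weakDeriv, G₂_apply, G₂_apply,
    ← h2 k, Complex.re_ofReal_mul, Complex.re_ofReal_mul]
  refine mul_le_mul_of_nonneg_left ?_ (hβ k).le
  have h3 : 0 ≤ ‖weakDeriv ((x : X₂) k)‖ ^ 2 := by positivity
  simp only [Complex.sub_re, Complex.mul_re, Complex.conj_re, Complex.conj_im]
  rw [← Complex.ofReal_pow, Complex.ofReal_re]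
  linarith

/-- The linear interpolation of the node values, a right inverse of `G₂`. -/
def interpolation (β : Fin 3 → ℝ) : U₂ →ₗ[ℂ] (L₂ β).domain :=
  LinearMap.codRestrict (L₂ β).domain
    { toFun := fun u => (WithLp.toLp 2 fun k =>
        u k • oneLp + volterra ((u (k + 1) - u k) • oneLp + volterra 0) : X₂)
      map_add' := fun u v => by
        ext1 k
        simp only [PiLp.add_apply, map_zero, add_zero, map_smul]
        module
      map_smul' := fun c u => by
        ext1 k
        simp only [PiLp.smul_apply, map_zero, add_zero, map_smul, smul_eq_mul, RingHom.id_apply]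
        module } fun u => by
    have h1 := fun k => isWeakDeriv_add_volterra (u k) ((u (k + 1) - u k) • oneLp + volterra 0)
    refine mem_domL₂.2 ⟨fun k => ⟨(h1 k).memH1, ?_⟩, fun k => ?_⟩
    · simp only [LinearMap.coe_mk, AddHom.coe_mk]
      rw [(h1 k).weakDeriv_eq]
      exact (isWeakDeriv_add_volterra _ _).memH1
    · simp only [LinearMap.coe_mk, AddHom.coe_mk]
      rw [pointValue_zero_add_volterra, pointValue_one_add_volterra, map_zero, add_zero,
        inner_smul_right, inner_oneLp_oneLp]
      ring

lemma interpolation_apply (β : Fin 3 → ℝ) (u : U₂) (k : Fin 3) :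
    (interpolation β u : X₂) k =
      u k • oneLp + volterra ((u (k + 1) - u k) • oneLp + volterra 0) := rfl

lemma G₂_interpolation (β : Fin 3 → ℝ) (u : U₂) : G₂ β (interpolation β u) = u := by
  ext k
  rw [G₂_apply, interpolation_apply, pointValue_zero_add_volterra]

lemma L₂_interpolation (β : Fin 3 → ℝ) (u : U₂) : L₂ β (interpolation β u) = 0 := by
  ext1 k
  rw [L₂_apply, interpolation_apply, (isWeakDeriv_add_volterra _ _).weakDeriv_eq,
    (isWeakDeriv_add_volterra _ _).weakDeriv_eq, smul_zero]
  rfl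

theorem isImpedancePassiveBoundaryNode {β : Fin 3 → ℝ} (hβ : ∀ k, 0 < β k) :
    IsImpedancePassiveBoundaryNode (L₂ β) (G₂ β) (K₂ β) where
  bounded_G := exists_norm_G₂_le hβ
  bounded_K := exists_norm_K₂_le hβ
  generates := by
    have h := isNegInverse_invNegA₂ hβ
    have hR := isPositive_invNegA₂ hβ
    exact ⟨_, isC0Semigroup_expNegInv hR h.injective, isGeneratorOf_expNegInv h hR⟩
  right_inverse := by
    refine ⟨interpolation β, ?_, G₂_interpolation β⟩
    let E : U₂ →L[ℂ] X₂ :=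
      LinearMap.toContinuousLinearMap ((L₂ β).domain.subtype ∘ₗ interpolation β)
    refine ⟨‖E‖, fun u => ?_⟩
    rw [L₂_interpolation, norm_zero, add_zero]
    exact E.le_opNorm u
  passive := re_inner_L₂_le hβ

/-! ### Estimates for hyperbolic functions -/

lemma exists_sqrt_re_pos {z : ℂ} (hz : 0 < z.re) :
    ∃ q : ℂ, q ^ 2 = z ∧ √z.re ≤ q.re := by
  obtain ⟨q, hq⟩ := IsAlgClosed.exists_pow_nat_eq z (n := 2) (by norm_num)
  have h1 : ∀ p : ℂ, p ^ 2 = z → 0 ≤ p.re → √z.re ≤ p.re := by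
    rintro p rfl hp
    refine Real.sqrt_le_iff.2 ⟨hp, ?_⟩
    rw [sq p, Complex.mul_re]
    nlinarith [sq_nonneg p.im]
  rcases le_total 0 q.re with h | h
  · exact ⟨q, hq, h1 q hq h⟩
  · exact ⟨-q, by rw [neg_sq, hq], h1 _ (by rw [neg_sq, hq]) (by simpa using h)⟩

lemma sinh_re_le_norm_sinh (q : ℂ) : Real.sinh q.re ≤ ‖Complex.sinh q‖ := by
  have h1 := norm_sub_norm_le (Complex.exp q) (Complex.exp (-q))
  rw [Complex.norm_exp, Complex.norm_exp, Complex.neg_re] at h1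
  rw [Complex.sinh, Real.sinh_eq, norm_div, Complex.norm_ofNat]
  gcongr

lemma norm_cosh_le_cosh_re (q : ℂ) : ‖Complex.cosh q‖ ≤ Real.cosh q.re := by
  have h1 := norm_add_le (Complex.exp q) (Complex.exp (-q))
  rw [Complex.norm_exp, Complex.norm_exp, Complex.neg_re] at h1
  rw [Complex.cosh, Real.cosh_eq, norm_div, Complex.norm_ofNat]
  gcongr

lemma sinh_ne_zero_of_re_pos {q : ℂ} (hq : 0 < q.re) : Complex.sinh q ≠ 0 :=
  norm_pos_iff.1 ((Real.sinh_pos_iff.2 hq).trans_le (sinh_re_le_norm_sinh q))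

lemma norm_inv_sinh_le {q : ℂ} {r : ℝ} (hr : 0 < r) (hq : r ≤ q.re) :
    ‖(Complex.sinh q)⁻¹‖ ≤ r⁻¹ := by
  rw [norm_inv]
  gcongr
  exact hq.trans ((Real.self_le_sinh_iff.2 (hr.le.trans hq)).trans (sinh_re_le_norm_sinh q))

lemma norm_cosh_div_sinh_le {q : ℂ} {r : ℝ} (hr : 0 < r) (hq : r ≤ q.re) :
    ‖Complex.cosh q / Complex.sinh q‖ ≤ 1 + r⁻¹ := by
  have h0 : r ≤ Real.sinh q.re := hq.trans (Real.self_le_sinh_iff.2 (hr.le.trans hq))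
  have h1 : Real.cosh q.re ≤ 1 + Real.sinh q.re := by
    have h2 := Real.cosh_sub_sinh q.re
    have h3 : Real.exp (-q.re) ≤ 1 := Real.exp_le_one_iff.2 (by linarith)
    linarith
  have h2 := sinh_re_le_norm_sinh q
  have h3 : 0 < Real.sinh q.re := hr.trans_le h0
  rw [norm_div]
  calc ‖Complex.cosh q‖ / ‖Complex.sinh q‖ ≤ (1 + Real.sinh q.re) / Real.sinh q.re := by
        gcongr
        exact (norm_cosh_le_cosh_re q).trans h1
    _ = 1 + (Real.sinh q.re)⁻¹ := by field_simp; ring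
    _ ≤ 1 + r⁻¹ := by gcongr

/-- A lower bound for `Re (q tanh (q/2)) / r` and `Re (q coth (q/2)) / r` at `q = r (1 ± i)`. -/
def coercivity (r : ℝ) : ℝ := (Real.sinh r - r) / (Real.cosh r + 1)

lemma coercivity_pos {r : ℝ} (hr : 0 < r) : 0 < coercivity r :=
  div_pos (sub_pos.2 (Real.self_lt_sinh_iff.2 hr)) (by positivity)

/-- The derivative is `r sinh r / (cosh r + 1)²`. -/
lemma monotoneOn_coercivity : MonotoneOn coercivity (Ici 0) := by
  have hd : ∀ r, HasDerivAt coercivity (((Real.cosh r - 1) * (Real.cosh r + 1) -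
      (Real.sinh r - r) * Real.sinh r) / (Real.cosh r + 1) ^ 2) r := fun r =>
    ((Real.hasDerivAt_sinh r).sub (hasDerivAt_id r)).div ((Real.hasDerivAt_cosh r).add_const 1)
      (by positivity)
  refine monotoneOn_of_deriv_nonneg (convex_Ici 0)
    (fun r _ => (hd r).continuousAt.continuousWithinAt)
    (fun r _ => (hd r).differentiableAt.differentiableWithinAt) fun r hr => ?_
  rw [interior_Ici] at hr
  rw [(hd r).deriv]
  refine div_nonneg ?_ (by positivity)
  have h1 := Real.cosh_sq r
  have h2 : 0 ≤ r * Real.sinh r := mul_nonneg hr.out.le (Real.sinh_nonneg_iff.2 hr.out.le)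
  nlinarith

/-- At `q = r (1 ± i)`, write `C, S, c, s` for the values of `cosh, sinh, cos, sin` at `r`. Then
`Re (q (cosh q - 1) / sinh q) = r (S - s) / (C + c)` and
`Re (q (cosh q + 1) / sinh q) = r (S + s) / (C - c)`. -/
lemma coercivity_le {r σ : ℝ} (hr : 0 < r) (hσ : σ ^ 2 = 1) {q : ℂ}
    (hq : q = r * (1 + σ * Complex.I)) :
    r * coercivity r + |(q / Complex.sinh q).re| ≤ (q * Complex.cosh q / Complex.sinh q).re := by
  set C := Real.cosh r with hC
  set S := Real.sinh r with hS
  set c := Real.cos r with hc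
  set s := Real.sin r with hs
  have hσ' : Real.cos (r * σ) = c ∧ Real.sin (r * σ) = σ * s := by
    rcases eq_or_eq_neg_of_sq_eq_sq σ 1 (by rw [hσ, one_pow]) with rfl | rfl <;> simp [hc, hs]
  have e0 : q = (r : ℂ) + ((r * σ : ℝ) : ℂ) * Complex.I := by rw [hq]; push_cast; ring
  have eS : Complex.sinh q = ⟨S * c, σ * (C * s)⟩ := by
    rw [e0, Complex.sinh_add, Complex.sinh_mul_I, Complex.cosh_mul_I, ← Complex.ofReal_sinh,
      ← Complex.ofReal_cosh, ← Complex.ofReal_sin, ← Complex.ofReal_cos, hσ'.1, hσ'.2]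
    apply Complex.ext <;>
      simp only [Complex.add_re, Complex.add_im, Complex.mul_re, Complex.mul_im, Complex.ofReal_re,
        Complex.ofReal_im, Complex.I_re, Complex.I_im] <;>
      ring
  have eC : Complex.cosh q = ⟨C * c, σ * (S * s)⟩ := by
    rw [e0, Complex.cosh_add, Complex.sinh_mul_I, Complex.cosh_mul_I, ← Complex.ofReal_sinh,
      ← Complex.ofReal_cosh, ← Complex.ofReal_sin, ← Complex.ofReal_cos, hσ'.1, hσ'.2]
    apply Complex.ext <;>
      simp only [Complex.add_re, Complex.add_im, Complex.mul_re, Complex.mul_im, Complex.ofReal_re,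
        Complex.ofReal_im, Complex.I_re, Complex.I_im] <;>
      ring
  have eq' : q = ⟨r, r * σ⟩ := by
    rw [e0]
    apply Complex.ext <;> simp
  have hCS : C ^ 2 = S ^ 2 + 1 := Real.cosh_sq r
  have hcs : s ^ 2 + c ^ 2 = 1 := Real.sin_sq_add_cos_sq r
  have hC1 : 1 < C := Real.one_lt_cosh.2 hr.ne'
  have hc1 : c ≤ 1 := Real.cos_le_one r
  have hc2 : -1 ≤ c := Real.neg_one_le_cos r
  have hs1 : |s| ≤ r := by
    rw [abs_le]
    have := Real.abs_sin_le_abs (x := r)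
    rw [abs_of_pos hr] at this
    exact abs_le.1 this
  have hs2 := abs_le.1 hs1
  have hSr : r ≤ S := Real.self_le_sinh_iff.2 hr.le
  have hd1 : 0 < C + c := by linarith
  have hd2 : 0 < C - c := by linarith
  have hn : Complex.normSq (Complex.sinh q) = (C - c) * (C + c) := by
    rw [eS, Complex.normSq_mk]
    linear_combination C ^ 2 * s ^ 2 * hσ +
      C ^ 2 * hcs - c ^ 2 * hCS
  have e1 : (q / Complex.sinh q).re = r * (S * c + C * s) / ((C - c) * (C + c)) := by
    rw [Complex.div_re, hn, eS, eq', ← add_div]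
    congr 1
    simp only
    linear_combination (r * C * s) * hσ
  have e2 : (q * Complex.cosh q / Complex.sinh q).re =
      r * (C * S + s * c) / ((C - c) * (C + c)) := by
    rw [Complex.div_re, hn, eS, eC, eq', ← add_div]
    congr 1
    simp only [Complex.mul_re, Complex.mul_im]
    linear_combination (-r * S ^ 2 * s * c + r * C * S * s ^ 2 + r * C ^ 2 * s * c) * hσ +
      r * C * S * hcs + r * s * c * hCS
  rw [e1, e2, ← le_sub_iff_add_le', abs_le]
  have f1 : r * (C * S + s * c) / ((C - c) * (C + c)) - r * (S * c + C * s) / ((C - c) * (C + c))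
      = r * ((S - s) / (C + c)) := by
    field_simp
    ring
  have f2 : r * (C * S + s * c) / ((C - c) * (C + c)) + r * (S * c + C * s) / ((C - c) * (C + c))
      = r * ((S + s) / (C - c)) := by
    field_simp
    ring
  have g1 : coercivity r ≤ (S - s) / (C + c) := by
    rw [coercivity, ← hC, ← hS]
    apply div_le_div₀ <;> linarith
  have g2 : coercivity r ≤ (S + s) / (C - c) := by
    rw [coercivity, ← hC, ← hS]
    apply div_le_div₀ <;> linarith
  have g1' := mul_le_mul_of_nonneg_left g1 hr.le
  have g2' := mul_le_mul_of_nonneg_left g2 hr.le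
  constructor <;> linarith

/-! ### The transfer function -/

/-- A continuous function as an element of `L²(0,1)`. -/
def contLp (u : ℝ → ℂ) (hu : Continuous u) : L2I := (memLp_of_continuousOn hu.continuousOn).toLp

lemma contLp_ae {u : ℝ → ℂ} (hu : Continuous u) : contLp u hu =ᵐ[volI] u := MemLp.coeFn_toLp _

lemma pointValue_contLp {u : ℝ → ℂ} (hu : Continuous u) {a : ℝ} (ha : a ∈ Icc (0 : ℝ) 1) :
    pointValue a (contLp u hu) = u a :=
  IsContRep.pointValue_eq ⟨hu.continuousOn, contLp_ae hu⟩ ha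

lemma isWeakDeriv_contLp {u u' : ℝ → ℂ} (hu : Continuous u) (hu' : Continuous u')
    (h : ∀ x, HasDerivAt u (u' x) x) : IsWeakDeriv (contLp u hu) (contLp u' hu') := by
  refine isWeakDeriv_iff.2 ⟨u 0, ?_⟩
  filter_upwards [contLp_ae hu, ae_restrict_mem measurableSet_Ioo] with x hx hx'
  rw [hx, primitive_congr (contLp_ae hu') (Ioo_subset_Icc_self hx'),
    intervalIntegral.integral_eq_sub_of_hasDerivAt (fun y _ => h y) (hu'.intervalIntegrable _ _)]
  ring

lemma hasDerivAt_ofReal_mul_add (p q : ℂ) (x : ℝ) :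
    HasDerivAt (fun x : ℝ => q * (x : ℂ) + p) q x := by
  simpa using ((Complex.ofRealCLM.hasDerivAt (x := x)).const_mul q).add_const p

lemma hasDerivAt_sinh_ofReal_mul_add (p q : ℂ) (x : ℝ) :
    HasDerivAt (fun x : ℝ => Complex.sinh (q * x + p)) (Complex.cosh (q * x + p) * q) x :=
  HasDerivAt.comp (h₂ := Complex.sinh) x (Complex.hasDerivAt_sinh (q * x + p))
    (hasDerivAt_ofReal_mul_add p q x)

lemma hasDerivAt_cosh_ofReal_mul_add (p q : ℂ) (x : ℝ) :
    HasDerivAt (fun x : ℝ => Complex.cosh (q * x + p)) (Complex.sinh (q * x + p) * q) x :=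
  HasDerivAt.comp (h₂ := Complex.cosh) x (Complex.hasDerivAt_cosh (q * x + p))
    (hasDerivAt_ofReal_mul_add p q x)

/-- The solution of `w'' = q² w`, `w(0) = a`, `w(1) = b` is
`(a sinh (q (1 - x)) + b sinh (q x)) / sinh q`. -/
lemma exists_edge_solution {q : ℂ} (hq : Complex.sinh q ≠ 0) (a b : ℂ) :
    ∃ w : L2I, MemH2 w ∧ weakDeriv (weakDeriv w) = q ^ 2 • w ∧
      pointValue 0 w = a ∧ pointValue 1 w = b ∧
      pointValue 0 (weakDeriv w) = q / Complex.sinh q * (b - a * Complex.cosh q) ∧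
      pointValue 1 (weakDeriv w) = q / Complex.sinh q * (b * Complex.cosh q - a) := by
  set S := Complex.sinh q with hS
  let u : ℝ → ℂ := fun x => (a * Complex.sinh (-q * x + q) + b * Complex.sinh (q * x + 0)) / S
  let u' : ℝ → ℂ := fun x =>
    (a * (Complex.cosh (-q * x + q) * -q) + b * (Complex.cosh (q * x + 0) * q)) / S
  let u'' : ℝ → ℂ := fun x =>
    (a * (Complex.sinh (-q * x + q) * -q * -q) + b * (Complex.sinh (q * x + 0) * q * q)) / S
  have h1 : ∀ x, HasDerivAt u (u' x) x := fun x =>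
    (((hasDerivAt_sinh_ofReal_mul_add q (-q) x).const_mul a).add
      ((hasDerivAt_sinh_ofReal_mul_add 0 q x).const_mul b)).div_const S
  have h2 : ∀ x, HasDerivAt u' (u'' x) x := fun x =>
    ((((hasDerivAt_cosh_ofReal_mul_add q (-q) x).mul_const (-q)).const_mul a).add
      (((hasDerivAt_cosh_ofReal_mul_add 0 q x).mul_const q).const_mul b)).div_const S
  have c0 : Continuous u := continuous_iff_continuousAt.2 fun x => (h1 x).continuousAt
  have c1 : Continuous u' := continuous_iff_continuousAt.2 fun x => (h2 x).continuousAt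
  have e2 : u'' = fun x => q ^ 2 * u x := by
    ext x
    simp only [u'', u]
    ring
  have c2 : Continuous u'' := by
    rw [e2]
    exact continuous_const.mul c0
  have w1 := isWeakDeriv_contLp c0 c1 h1
  have w2 := isWeakDeriv_contLp c1 c2 h2
  refine ⟨contLp u c0, ⟨w1.memH1, ?_⟩, ?_, ?_, ?_, ?_, ?_⟩
  · rw [w1.weakDeriv_eq]
    exact w2.memH1
  · rw [w1.weakDeriv_eq, w2.weakDeriv_eq]
    refine Lp.ext ?_
    filter_upwards [contLp_ae c0, contLp_ae c2, Lp.coeFn_smul (q ^ 2) (contLp u c0)] with x i1 i2 i3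
    rw [i2, i3, Pi.smul_apply, i1, e2, smul_eq_mul]
  · rw [pointValue_contLp c0 zero_mem_I]
    simp [u, ← hS, hq]
  · rw [pointValue_contLp c0 one_mem_I]
    simp [u, ← hS, hq]
  · rw [w1.weakDeriv_eq, pointValue_contLp c1 zero_mem_I]
    simp [u']
    ring
  · rw [w1.weakDeriv_eq, pointValue_contLp c1 one_mem_I]
    simp [u']
    ring

/-- The sesquilinear form of the transfer function, as a sum over the edges of the network, in
terms of numbers `q k` with `β k * (q k)² = z`. -/
lemma inner_transferFunction {β : Fin 3 → ℝ} {P : ℂ → U₂ →L[ℂ] U₂}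
    (hP : IsTransferFunction (L₂ β) (G₂ β) (K₂ β) P) {z : ℂ} (hz : z ∈ resolventSet (A₂ β))
    {q : Fin 3 → ℂ} (hq : ∀ k, (β k : ℂ) * q k ^ 2 = z) (hS : ∀ k, Complex.sinh (q k) ≠ 0)
    (v u : U₂) :
    inner ℂ v (P z u) = ∑ k, (β k : ℂ) * (q k / Complex.sinh (q k) *
      (starRingEnd ℂ (v (k + 1)) * (u (k + 1) * Complex.cosh (q k) - u k) -
        starRingEnd ℂ (v k) * (u (k + 1) - u k * Complex.cosh (q k)))) := by
  choose w h1 h2 h3 h4 h5 h6 using fun k => exists_edge_solution (hS k) (u k) (u (k + 1))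
  have hx : (WithLp.toLp 2 w : X₂) ∈ (L₂ β).domain :=
    mem_domL₂.2 ⟨h1, fun k => (h4 k).trans (h3 (k + 1)).symm⟩
  have hL : z • ((⟨WithLp.toLp 2 w, hx⟩ : (L₂ β).domain) : X₂) -
      L₂ β ⟨WithLp.toLp 2 w, hx⟩ = 0 := by
    rw [sub_eq_zero]
    ext1 k
    rw [L₂_apply]
    simp only [PiLp.smul_apply]
    rw [h2 k, smul_smul, hq]
  have hG : G₂ β ⟨WithLp.toLp 2 w, hx⟩ = u := by
    ext k
    exact h3 k
  obtain ⟨y, -, h7, h8⟩ := hP z hz u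
  rw [h8, ← h7 _ ⟨hL, hG⟩, inner_K₂]
  refine Finset.sum_congr rfl fun k _ => ?_
  simp only [h5, h6]
  ring

/-- With `β q² = 1 + i s` and `Re q ≥ β^{-1/2}`, both `coth q` and `1 / sinh q` are bounded, and
`|q|` is of order `1 + |s|^{1/2}`. -/
lemma exists_norm_transferFunction_le {β : Fin 3 → ℝ} (hβ : ∀ k, 0 < β k) {P : ℂ → U₂ →L[ℂ] U₂}
    (hP : IsTransferFunction (L₂ β) (G₂ β) (K₂ β) P)
    (hz : ∀ s : ℝ, 1 + Complex.I * s ∈ resolventSet (A₂ β)) :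
    ∃ C : ℝ, 0 < C ∧ ∀ s : ℝ, ‖P (1 + Complex.I * s)‖ ≤ C * (1 + |s| ^ (1 / 2 : ℝ)) := by
  let r : Fin 3 → ℝ := fun k => √(β k)⁻¹
  have hr : ∀ k, 0 < r k := fun k => Real.sqrt_pos.2 (inv_pos.2 (hβ k))
  let C : Fin 3 → ℝ := fun k => β k * (r k * (2 * (1 + (r k)⁻¹) + 2 * (r k)⁻¹))
  have hC : ∀ k, 0 < C k := fun k => by
    have := hr k
    have := hβ k
    positivity
  refine ⟨∑ k, C k, Finset.sum_pos (fun k _ => hC k) ⟨0, Finset.mem_univ 0⟩, fun s => ?_⟩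
  set z : ℂ := 1 + Complex.I * s with hzs
  set m : ℝ := 1 + |s| ^ (1 / 2 : ℝ) with hm
  have hm0 : 0 < m := by positivity
  have hb : ∀ k, (β k : ℂ) ≠ 0 := fun k => Complex.ofReal_ne_zero.2 (hβ k).ne'
  have hre : ∀ k, (z / β k).re = (β k)⁻¹ := fun k => by
    rw [Complex.div_ofReal_re, hzs]
    simp
  choose q hq1 hq2 using fun k => exists_sqrt_re_pos (z := z / β k)
    (by rw [hre]; exact inv_pos.2 (hβ k))
  have hq3 : ∀ k, r k ≤ (q k).re := fun k => by
    have := hq2 k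
    rwa [hre] at this
  have hq4 : ∀ k, ‖q k‖ ≤ r k * m := fun k => by
    refine abs_le_of_sq_le_sq' ?_ (by have := hr k; positivity) |>.2
    rw [← norm_pow, hq1, mul_pow, Real.sq_sqrt (inv_nonneg.2 (hβ k).le), norm_div,
      Complex.norm_real, Real.norm_of_nonneg (hβ k).le, div_eq_inv_mul]
    refine mul_le_mul_of_nonneg_left ?_ (inv_nonneg.2 (hβ k).le)
    have h1 : ‖z‖ ≤ 1 + |s| := by
      refine (norm_add_le _ _).trans ?_
      simp
    have h2 : (|s| ^ (1 / 2 : ℝ)) ^ 2 = |s| := by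
      rw [← Real.sqrt_eq_rpow, Real.sq_sqrt (abs_nonneg s)]
    have h3 : 0 ≤ |s| ^ (1 / 2 : ℝ) := by positivity
    rw [hm]
    nlinarith
  have hS : ∀ k, Complex.sinh (q k) ≠ 0 := fun k =>
    sinh_ne_zero_of_re_pos ((hr k).trans_le (hq3 k))
  have hq5 : ∀ k, (β k : ℂ) * q k ^ 2 = z := fun k => by rw [hq1, mul_div_cancel₀ _ (hb k)]
  have hform : ∀ v u : U₂, ‖inner ℂ v (P z u)‖ ≤ (∑ k, C k) * m * ‖v‖ * ‖u‖ := fun v u => by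
    rw [inner_transferFunction hP (hz s) hq5 hS, Finset.sum_mul, Finset.sum_mul, Finset.sum_mul]
    refine (norm_sum_le _ _).trans (Finset.sum_le_sum fun k _ => ?_)
    set a := (q k) / Complex.sinh (q k) with ha
    have e : a * (starRingEnd ℂ (v (k + 1)) * (u (k + 1) * Complex.cosh (q k) - u k) -
        starRingEnd ℂ (v k) * (u (k + 1) - u k * Complex.cosh (q k))) =
        q k * (Complex.cosh (q k) / Complex.sinh (q k) *
          (starRingEnd ℂ (v (k + 1)) * u (k + 1) + starRingEnd ℂ (v k) * u k) -
        (Complex.sinh (q k))⁻¹ *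
          (starRingEnd ℂ (v (k + 1)) * u k + starRingEnd ℂ (v k) * u (k + 1))) := by
      rw [ha]
      ring
    have hvu : ∀ i j, ‖starRingEnd ℂ (v i) * u j‖ ≤ ‖v‖ * ‖u‖ := fun i j => by
      rw [norm_mul, RCLike.norm_conj]
      exact mul_le_mul (PiLp.norm_apply_le v i) (PiLp.norm_apply_le u j) (norm_nonneg _)
        (norm_nonneg _)
    have hr' := hr k
    have hβ' := hβ k
    rw [e, norm_mul, norm_mul, Complex.norm_real, Real.norm_of_nonneg (hβ k).le]
    calc β k * (‖q k‖ * _) ≤ β k * ((r k * m) *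
          ((1 + (r k)⁻¹) * (‖v‖ * ‖u‖ + ‖v‖ * ‖u‖) + (r k)⁻¹ * (‖v‖ * ‖u‖ + ‖v‖ * ‖u‖))) := by
          gcongr
          · exact hq4 k
          · refine (norm_sub_le _ _).trans ?_
            rw [norm_mul, norm_mul]
            gcongr
            · exact norm_cosh_div_sinh_le hr' (hq3 k)
            · exact (norm_add_le _ _).trans (add_le_add (hvu _ _) (hvu _ _))
            · exact norm_inv_sinh_le hr' (hq3 k)
            · exact (norm_add_le _ _).trans (add_le_add (hvu _ _) (hvu _ _))
      _ = C k * m * ‖v‖ * ‖u‖ := by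
          simp only [C]
          ring
  have hC0 : 0 ≤ ∑ k, C k := Finset.sum_nonneg fun k _ => (hC k).le
  refine ContinuousLinearMap.opNorm_le_bound _ (by positivity) fun u => ?_
  rcases eq_or_ne (P z u) 0 with h0 | h0
  · rw [h0, norm_zero]
    positivity
  · have h1 := hform (P z u) u
    rw [inner_self_eq_norm_sq_to_K, norm_pow] at h1
    have h2 : 0 < ‖P z u‖ := norm_pos_iff.2 h0
    refine le_of_mul_le_mul_left ?_ h2
    have h3 : ‖((‖P z u‖ : ℝ) : ℂ)‖ = ‖P z u‖ := by simp
    have h4 : ‖P z u‖ ^ 2 ≤ (∑ k, C k) * m * ‖P z u‖ * ‖u‖ := by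
      rw [← h3]
      simpa using h1
    nlinarith

/-- The real part of the form of one edge at `q = r (1 ± i)`. -/
lemma coercivity_le_re_form {r σ : ℝ} (hr : 0 < r) (hσ : σ ^ 2 = 1) {q : ℂ}
    (hq : q = r * (1 + σ * Complex.I)) (a b : ℂ) :
    r * coercivity r * (‖a‖ ^ 2 + ‖b‖ ^ 2) ≤
      (q / Complex.sinh q * (starRingEnd ℂ b * (b * Complex.cosh q - a) -
        starRingEnd ℂ a * (b - a * Complex.cosh q))).re := by
  have h := coercivity_le hr hσ hq
  set t := (starRingEnd ℂ a * b).re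
  have e : (q / Complex.sinh q * (starRingEnd ℂ b * (b * Complex.cosh q - a) -
        starRingEnd ℂ a * (b - a * Complex.cosh q))) =
      ((‖a‖ ^ 2 + ‖b‖ ^ 2 : ℝ) : ℂ) * (q * Complex.cosh q / Complex.sinh q) -
        ((2 * t : ℝ) : ℂ) * (q / Complex.sinh q) := by
    have h1 : starRingEnd ℂ a * b + starRingEnd ℂ b * a = ((2 * t : ℝ) : ℂ) := by
      have := Complex.add_conj (starRingEnd ℂ a * b)
      rw [map_mul, Complex.conj_conj] at this
      rw [← this]
      ring
    have h2 : ((‖a‖ ^ 2 + ‖b‖ ^ 2 : ℝ) : ℂ) = starRingEnd ℂ a * a + starRingEnd ℂ b * b := by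
      rw [Complex.conj_mul', Complex.conj_mul']
      push_cast
      rfl
    rw [← h1, h2]
    ring
  have ht : |2 * t| ≤ ‖a‖ ^ 2 + ‖b‖ ^ 2 := by
    have h1 : |t| ≤ ‖a‖ * ‖b‖ := by
      refine (Complex.abs_re_le_norm _).trans ?_
      rw [norm_mul, RCLike.norm_conj]
    rw [abs_mul, abs_two]
    nlinarith [sq_nonneg (‖a‖ - ‖b‖)]
  rw [e, Complex.sub_re, Complex.re_ofReal_mul, Complex.re_ofReal_mul]
  set X := (q * Complex.cosh q / Complex.sinh q).re
  set Y := (q / Complex.sinh q).re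
  set n := ‖a‖ ^ 2 + ‖b‖ ^ 2
  have h1 : 2 * t * Y ≤ n * |Y| := by
    refine (le_abs_self _).trans ?_
    rw [abs_mul]
    gcongr
  have hn : 0 ≤ n := by positivity
  nlinarith [mul_le_mul_of_nonneg_left h hn]

/-- On the imaginary axis, `β q² = i s` for `q = r (1 ± i)` with `r = (|s| / (2 β))^{1/2}`. -/
lemma exists_le_re_inner_transferFunction {β : Fin 3 → ℝ} (hβ : ∀ k, 0 < β k)
    {P : ℂ → U₂ →L[ℂ] U₂} (hP : IsTransferFunction (L₂ β) (G₂ β) (K₂ β) P)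
    (hz : ∀ s : ℝ, Complex.I * s ∈ resolventSet (A₂ β)) {ε : ℝ} (hε : 0 < ε) :
    ∃ c : ℝ, 0 < c ∧ ∀ s : ℝ, ε ≤ |s| → ∀ u : U₂,
      c * (1 + |s| ^ (1 / 2 : ℝ)) * ‖u‖ ^ 2 ≤ (inner ℂ u (P (Complex.I * s) u)).re := by
  let d : Fin 3 → ℝ := fun k => √(2 * β k)
  have hd : ∀ k, 0 < d k := fun k => Real.sqrt_pos.2 (mul_pos two_pos (hβ k))
  -- `coercivity r` is at least its value at `|s| = ε`, where `r = √ε / d k`, and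
  -- `r / (1 + |s|^{1/2}) ≥ 1 / (d k * (1 + 1 / √ε))` as soon as `|s| ≥ ε`
  let m : Fin 3 → ℝ := fun k => β k * (coercivity (√ε / d k) / (d k * (1 + (√ε)⁻¹)))
  have hm : ∀ k, 0 < m k := fun k => by
    have h1 := hd k
    have h2 := hβ k
    have h3 : 0 < coercivity (√ε / d k) := coercivity_pos (by positivity)
    positivity
  obtain ⟨k₀, hk₀⟩ := Finite.exists_min m
  refine ⟨m k₀, hm k₀, fun s hs u => ?_⟩
  rw [← Real.sqrt_eq_rpow]
  have hs0 : 0 < |s| := hε.trans_le hs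
  set t := √|s| with ht
  have ht0 : 0 < t := Real.sqrt_pos.2 hs0
  have htε : √ε ≤ t := Real.sqrt_le_sqrt hs
  have hε' : 0 < √ε := Real.sqrt_pos.2 hε
  have ht1 : 1 + t ≤ t * (1 + (√ε)⁻¹) := by
    have : 1 ≤ t * (√ε)⁻¹ := by
      rw [← div_eq_mul_inv, le_div_iff₀ hε', one_mul]
      exact htε
    linarith
  obtain ⟨σ, hσ, hσs⟩ : ∃ σ : ℝ, σ ^ 2 = 1 ∧ σ * |s| = s := by
    rcases le_total 0 s with h | h
    · exact ⟨1, by norm_num, by rw [abs_of_nonneg h, one_mul]⟩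
    · exact ⟨-1, by norm_num, by rw [abs_of_nonpos h]; ring⟩
  let r : Fin 3 → ℝ := fun k => t / d k
  have hr : ∀ k, 0 < r k := fun k => div_pos ht0 (hd k)
  let q : Fin 3 → ℂ := fun k => r k * (1 + σ * Complex.I)
  have hq : ∀ k, (β k : ℂ) * q k ^ 2 = Complex.I * s := fun k => by
    have h1 : r k ^ 2 = |s| / (2 * β k) := by
      rw [div_pow, Real.sq_sqrt hs0.le, Real.sq_sqrt (mul_pos two_pos (hβ k)).le]
    have h2 : β k * (2 * r k ^ 2) = |s| := by
      have := hβ k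
      rw [h1]
      field_simp
    have h3 : (1 + (σ : ℂ) * Complex.I) ^ 2 = 2 * σ * Complex.I := by
      have : (σ : ℂ) ^ 2 = 1 := by exact_mod_cast hσ
      linear_combination (σ : ℂ) ^ 2 * Complex.I_sq - this
    calc (β k : ℂ) * q k ^ 2 = ((β k * (2 * r k ^ 2) : ℝ) : ℂ) * σ * Complex.I := by
          simp only [q]
          rw [mul_pow, h3]
          push_cast
          ring
      _ = Complex.I * ((σ * |s| : ℝ) : ℂ) := by
          rw [h2]
          push_cast
          ring
      _ = Complex.I * s := by rw [hσs]
  have hre : ∀ k, (q k).re = r k := fun k => by simp [q]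
  have hS : ∀ k, Complex.sinh (q k) ≠ 0 := fun k =>
    sinh_ne_zero_of_re_pos (by rw [hre]; exact hr k)
  rw [inner_transferFunction hP (hz s) hq hS, Complex.re_sum, EuclideanSpace.norm_sq_eq,
    Finset.mul_sum]
  refine Finset.sum_le_sum fun k _ => ?_
  rw [Complex.re_ofReal_mul]
  have hβ' := hβ k
  have hd' := hd k
  have h1 : coercivity (√ε / d k) ≤ coercivity (r k) := by
    refine monotoneOn_coercivity (mem_Ici.2 (by positivity)) (mem_Ici.2 (hr k).le) ?_
    simp only [r]
    gcongr
  have h0 : 0 < coercivity (√ε / d k) := coercivity_pos (by positivity)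
  calc m k₀ * (1 + t) * ‖u k‖ ^ 2 ≤ m k * (t * (1 + (√ε)⁻¹)) * ‖u k‖ ^ 2 := by
        gcongr
        exact hk₀ k
    _ = β k * (r k * coercivity (√ε / d k) * ‖u k‖ ^ 2) := by
        simp only [m, r]
        field_simp
    _ ≤ β k * (r k * coercivity (r k) * (‖u k‖ ^ 2 + ‖u (k + 1)‖ ^ 2)) := by
        have := hr k
        gcongr
        · exact mul_nonneg (hr k).le (h0.le.trans h1)
        · exact le_add_of_nonneg_right (sq_nonneg _)
    _ ≤ _ := by
        gcongr
        exact coercivity_le_re_form (hr k) hσ rfl _ _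

/-- An operator inequality `Re T ≥ c` in terms of the quadratic form of `T`. -/
lemma smul_one_le_rePart {U : Type*} [NormedAddCommGroup U] [InnerProductSpace ℂ U]
    [CompleteSpace U] {T : U →L[ℂ] U} {c : ℝ} (h : ∀ u, c * ‖u‖ ^ 2 ≤ (inner ℂ u (T u)).re) :
    (c : ℂ) • (1 : U →L[ℂ] U) ≤ rePart T := by
  rw [ContinuousLinearMap.le_def, ContinuousLinearMap.isPositive_def']
  have e : ∀ u v, inner ℂ ((rePart T - (c : ℂ) • (1 : U →L[ℂ] U)) u) v =
      (2 : ℂ)⁻¹ * (inner ℂ (T u) v + inner ℂ u (T v)) - c * inner ℂ u v := fun u v => by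
    simp [rePart, ContinuousLinearMap.adjoint_inner_left]
    ring
  constructor
  · refine ContinuousLinearMap.isSelfAdjoint_iff_isSymmetric.2 fun u v => ?_
    simp only [ContinuousLinearMap.coe_coe]
    rw [e, ← inner_conj_symm u ((rePart T - (c : ℂ) • (1 : U →L[ℂ] U)) v), e]
    simp only [map_sub, map_mul, map_add, map_inv₀, Complex.conj_ofNat, Complex.conj_ofReal,
      inner_conj_symm]
    ring
  · intro u
    rw [ContinuousLinearMap.reApplyInnerSelf_apply, e, inner_self_eq_norm_sq_to_K]
    have h1 := h u
    have h2 : (inner ℂ (T u) u).re = (inner ℂ u (T u)).re := by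
      rw [← inner_conj_symm, Complex.conj_re]
    have h3 : ((c : ℂ) * ((‖u‖ : ℝ) : ℂ) ^ 2) = ((c * ‖u‖ ^ 2 : ℝ) : ℂ) := by push_cast; rfl
    have h4 : (2 : ℂ)⁻¹ = ((2⁻¹ : ℝ) : ℂ) := by push_cast; rfl
    change 0 ≤ ((2 : ℂ)⁻¹ * (inner ℂ (T u) u + inner ℂ u (T u)) - (c : ℂ) * ((‖u‖ : ℝ) : ℂ) ^ 2).re
    rw [h3, h4, Complex.sub_re, Complex.re_ofReal_mul, Complex.add_re, h2, Complex.ofReal_re]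
    linarith

end HeatNetwork

end

open HeatNetwork in
theorem proposition3p2 (β : Fin 3 → ℝ) (hβ : ∀ k, 0 < β k) :
    IsImpedancePassiveBoundaryNode (L₂ β) (G₂ β) (K₂ β) ∧
    (∃ T : ℝ≥0 → X₂ →L[ℂ] X₂,
      IsC0Semigroup T ∧ IsGeneratorOf (A₂ β) T ∧ IsUniformlyExpStable T) ∧
    (∀ s : ℝ, 1 + Complex.I * s ∈ resolventSet (A₂ β) ∧ Complex.I * s ∈ resolventSet (A₂ β)) ∧
    ∃ P₂ : ℂ → U₂ →L[ℂ] U₂, IsTransferFunction (L₂ β) (G₂ β) (K₂ β) P₂ ∧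
      (∃ C : ℝ, 0 < C ∧ ∀ s : ℝ, ‖P₂ (1 + Complex.I * s)‖ ≤ C * (1 + |s| ^ (1 / 2 : ℝ))) ∧
      ∀ ε : ℝ, 0 < ε → ∃ c : ℝ, 0 < c ∧ ∀ s : ℝ, ε ≤ |s| →
        ((c * (1 + |s| ^ (1 / 2 : ℝ)) : ℝ) : ℂ) • (1 : U₂ →L[ℂ] U₂) ≤
          rePart (P₂ (Complex.I * s)) := by
  have h := isNegInverse_invNegA₂ hβ
  have hR := isPositive_invNegA₂ hβ
  have h1 : ∀ s : ℝ, 1 + Complex.I * s ∈ resolventSet (A₂ β) := fun s =>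
    h.mem_resolventSet hR (by simp)
  have h0 : ∀ s : ℝ, Complex.I * s ∈ resolventSet (A₂ β) := fun s =>
    h.mem_resolventSet hR (by simp)
  obtain ⟨P, hP⟩ := exists_isTransferFunction (K₂ β) (interpolation β) (G₂_interpolation β)
  refine ⟨isImpedancePassiveBoundaryNode hβ, ⟨expNegInv (invNegA₂ β),
    isC0Semigroup_expNegInv hR h.injective, isGeneratorOf_expNegInv h hR,
    isUniformlyExpStable_expNegInv hR⟩, fun s => ⟨h1 s, h0 s⟩, P, hP,
    exists_norm_transferFunction_le hβ hP h1, fun ε hε => ?_⟩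
  obtain ⟨c, hc, hc'⟩ := exists_le_re_inner_transferFunction hβ hP h0 hε
  exact ⟨c, hc, fun s hs => smul_one_le_rePart (hc' s hs)⟩
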